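/- Let $\mathbb{B}=\{0,1\}^{\mathbb{Z}}$ be the set of two-color sceneries $\xi:\mathbb{Z}\to\{0,1\}$, equipped with the $\sigma$-algebra $\sigma(\mathbb{B})$ generated by the coordinates, and let $P$ be the probability measure on $(\mathbb{B},\sigma(\mathbb{B}))$ under which the $\xi(i)$, $i\in\mathbb{Z}$, are i.i.d. Bernoulli variables with parameter $\tfrac12$. Let $(S(k))_{k\ge 0}$ be a simple symmetric random walk on $\mathbb{Z}$ with $S(0)=0$. Call two sceneries $\xi,\eta\in\mathbb{B}$ distinguishable if there is a measurable set $A\subset\{0,1\}^{\mathbb{N}}$ (for the $\sigma$-algebra generated by the coordinates, $\mathbb N=\{0,1,2,\dots\}$) such that almost surely $(\xi(S(k)))_{k\ge 0}\in A$ and almost surely $(\eta(S(k)))_{k\ge 0}\notin A$; that is, a single observed color record almost surely tells which of the two sceneries generated it. Then there exists a set $\mathbb{S}\in\sigma(\mathbb{B})$ with $P(\mathbb{S})=1$ such that for every $\xi\in\mathbb{S}$ and every scenery $\eta$ that is equal to $\xi$ everywhere except in exactly one point, $\xi$ and $\eta$ are distinguishable. -/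

import Mathlib

open MeasureTheory ProbabilityTheory

namespace SceneryReconstruction

/-- A two-color scenery. -/
abbrev Scenery : Type := ℤ → Fin 2

/-- The parameter `1/2`, as an element of the unit interval. -/
noncomputable def oneHalf : unitInterval := ⟨1 / 2, by norm_num, by norm_num⟩

/-- The law on sceneries under which the colors are i.i.d. Bernoulli with parameter `1/2`;
the sigma-algebra on `Scenery` is the product one, generated by the coordinates. -/
noncomputable def sceneryMeasure : Measure Scenery :=
  Measure.infinitePi fun _ : ℤ => bernoulliMeasure (1 : Fin 2) 0 oneHalf

/-- The law of an i.i.d. sequence of steps, each equal to `1` or `-1` with probability `1/2`. -/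
noncomputable def stepMeasure : Measure (ℕ → ℤ) :=
  Measure.infinitePi fun _ : ℕ => bernoulliMeasure (1 : ℤ) (-1) oneHalf

/-- The path with the given steps that starts at the origin. -/
def walk (steps : ℕ → ℤ) (k : ℕ) : ℤ := ∑ i ∈ Finset.range k, steps i

/-- The law of the simple random walk on `ℤ` started at the origin. -/
noncomputable def simpleRandomWalk : Measure (ℕ → ℤ) := stepMeasure.map walk

/-- The color record `k ↦ ξ (S k)` of the scenery `ξ` along the path `S`. -/
def colorRecord (ξ : Scenery) (S : ℕ → ℤ) : ℕ → Fin 2 := fun k => ξ (S k)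

/-- Two (known) sceneries are distinguishable if a measurable test applied to a single color
record decides almost surely which of them generated it: the test answers `ξ` when the record
lies in `A` and `η` otherwise, and it is almost surely right in both cases. -/
def Distinguishable (ξ η : Scenery) : Prop :=
  ∃ A : Set (ℕ → Fin 2), MeasurableSet A ∧
    (∀ᵐ S ∂simpleRandomWalk, colorRecord ξ S ∈ A) ∧
    (∀ᵐ S ∂simpleRandomWalk, colorRecord η S ∉ A)

/-- `η` agrees with `ξ` everywhere except in exactly one point. -/
def DifferInOnePoint (ξ η : Scenery) : Prop := ∃! x : ℤ, η x ≠ ξ x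

theorem measurable_walk : Measurable walk :=
  measurable_pi_lambda _ fun k =>
    Finset.measurable_sum (Finset.range k) fun i _ => measurable_pi_apply i

instance : IsProbabilityMeasure sceneryMeasure := by
  unfold sceneryMeasure; infer_instance

instance : IsProbabilityMeasure stepMeasure := by
  unfold stepMeasure; infer_instance

instance : IsProbabilityMeasure simpleRandomWalk :=
  Measure.isProbabilityMeasure_map measurable_walk.aemeasurable

end SceneryReconstruction

/-! Replace colors by edges. The edge from `z` to `z + 1` carries the bit `env ξ z`: whether its end
points agree in color, negated at odd `z`. With this parity twist, crossing an edge upwards or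
downwards shows opposite bits (`inc`), so the record reveals the successive increments of a height
`pot` along the walk. For a random scenery the edge bits are independent fair coins (`map_env`), and
changing the color at `x` turns exactly the two edges at `x` (`tw`).

The test declares `η` when every finite piece of the record can be produced by some path in `η` from
the origin. It is always right under `η`. Under `ξ` it errs only if, for every time, some path in
the turned environment, a follower, shows the same symbols as the walk up to that time. By
recurrence and the Markov property this is a null event as soon as, from a single site `z₀`, the
walk has positive probability to shake off followers from all starting points (`foll_null`).

Distant followers fail because their environment is independent of that of the walk. Follower and
walk always have equal heights (`pot_eq_of_foll`). Suppose that on both sides of the walk's start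
`b` the height continues outwards after first reaching absolute value `j`, that on both sides of the
follower's start `q` it turns back there, and that the walk steps outwards on first reaching such a
site. Then the walk attains absolute height `j + 1`, while the follower is still confined to sites
of absolute height at most `j` (`not_foll_of_corner`). Each level `j` offers this chance with
conditional probability `1 / 32`, so failure up to level `J` is exponentially unlikely, while the
distances and times involved are polynomial in `J`. Hence most sites are `Good`, polynomially many
at once (`exists_not_good_bound`).

Nearby followers are defeated by beacons: runs of ones, unique in a neighborhood, on either side of
`x`. While the walk goes straight from one beacon across `x` to the end of the other, a nearby
follower has to pass the same beacons at the same times, hence to cross the turned edge at `x`,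
where it shows the wrong bit (`far_of_straight`). `exists_escape` combines the two mechanisms, and
`ae_exists_escape` finds beacons at good sites for almost every environment. -/

open MeasureTheory ProbabilityTheory
open scoped ENNReal

namespace SceneryReconstruction

/-! ### Families of fair coins -/

/-- The law of a family of independent fair coins. -/
noncomputable def fair (κ : Type) : Measure (κ → Bool) :=
  Measure.infinitePi fun _ => bernoulliMeasure true false oneHalf

instance (κ : Type) : IsProbabilityMeasure (fair κ) := by
  unfold fair; infer_instance

/-- Turn the coin with index `i`. -/
def flipAt {κ : Type} [DecidableEq κ] (i : κ) (ω : κ → Bool) : κ → Bool :=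
  fun j => if j = i then !ω j else ω j

/-- Membership in `B` is decided by the coins with index in `I`. -/
def DepOn {κ : Type} (I : Set κ) (B : Set (κ → Bool)) : Prop :=
  ∀ ω ω' : κ → Bool, (∀ i ∈ I, ω i = ω' i) → ω ∈ B → ω' ∈ B

theorem symm_oneHalf : unitInterval.symm oneHalf = oneHalf := by
  ext; simp [oneHalf]; norm_num

theorem toNNReal_oneHalf : (unitInterval.toNNReal oneHalf : ℝ≥0∞) = 2⁻¹ := by
  have h : unitInterval.toNNReal oneHalf = 2⁻¹ := by
    ext; simp [oneHalf]
  rw [h]; simp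

theorem bernoulli_oneHalf_map {X Y : Type*} [MeasurableSpace X] [MeasurableSpace Y] (x y : X)
    {f : X → Y} (hf : Measurable f) :
    (bernoulliMeasure x y oneHalf).map f = bernoulliMeasure (f x) (f y) oneHalf := by
  simp only [bernoulliMeasure_def]
  rw [Measure.map_add _ _ hf, Measure.map_smul, Measure.map_smul, Measure.map_dirac' hf,
    Measure.map_dirac' hf]

theorem bernoulli_oneHalf_comm {X : Type*} [MeasurableSpace X] (x y : X) :
    bernoulliMeasure x y oneHalf = bernoulliMeasure y x oneHalf := by
  simp only [bernoulliMeasure_def, symm_oneHalf]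
  rw [add_comm]

theorem coin_singleton (b : Bool) : bernoulliMeasure true false oneHalf {b} = 2⁻¹ := by
  classical
  cases b
  · rw [bernoulli_oneHalf_comm, bernoulliMeasure_apply _ (measurableSet_singleton _)]
    simp [toNNReal_oneHalf]
  · rw [bernoulliMeasure_apply _ (measurableSet_singleton _)]
    simp [toNNReal_oneHalf]

section Flip

variable {κ : Type}

theorem measurableSet_coin (i : κ) (b : Bool) : MeasurableSet {ω : κ → Bool | ω i = b} :=
  measurableSet_eq_fun (measurable_pi_apply i) measurable_const

theorem DepOn.preimage_restrict {I : Finset κ} {B : Set (κ → Bool)} (hB : DepOn (I : Set κ) B) :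
    I.restrict ⁻¹' (I.restrict '' B) = B := by
  refine Set.Subset.antisymm ?_ (Set.subset_preimage_image _ _)
  rintro ω ⟨ω', h', he⟩
  refine hB ω' ω (fun i hi => ?_) h'
  exact congrFun he ⟨i, hi⟩

theorem DepOn.measurableSet {I : Finset κ} {B : Set (κ → Bool)} (hB : DepOn (I : Set κ) B) :
    MeasurableSet B := by
  rw [← hB.preimage_restrict]
  exact (measurable_pi_lambda _ fun i => measurable_pi_apply _) (Set.toFinite _).measurableSet

variable [DecidableEq κ]

theorem flipAt_same (i : κ) (ω : κ → Bool) : flipAt i ω i = !ω i := by simp [flipAt]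

theorem flipAt_ne {i j : κ} (h : j ≠ i) (ω : κ → Bool) : flipAt i ω j = ω j := by
  simp [flipAt, h]

theorem flipAt_flipAt (i : κ) (ω : κ → Bool) : flipAt i (flipAt i ω) = ω := by
  funext j; by_cases h : j = i <;> simp [flipAt, h]

theorem measurable_flipAt (i : κ) : Measurable (flipAt i) := by
  refine measurable_pi_lambda _ fun j => ?_
  by_cases h : j = i
  · simpa [flipAt, h, Function.comp_def] using
      (measurable_of_finite not).comp (measurable_pi_apply i)
  · simpa [flipAt, h] using measurable_pi_apply j

theorem fair_map_flipAt (i : κ) : (fair κ).map (flipAt i) = fair κ := by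
  have h := Measure.infinitePi_map_pi (μ := fun _ : κ => bernoulliMeasure true false oneHalf)
    (f := fun j b => if j = i then !b else b) (fun j => measurable_of_finite _)
  change (fair κ).map (flipAt i) = _ at h
  rw [h, fair]
  congr 1
  funext j
  rw [bernoulli_oneHalf_map _ _ (measurable_of_finite _)]
  by_cases hj : j = i
  · simpa [hj] using bernoulli_oneHalf_comm _ _
  · simp [hj]

/-- A probability measure that is invariant under turning single coins is the law of
independent fair coins. -/
theorem eq_fair_of_flip {μ : Measure (κ → Bool)} [IsProbabilityMeasure μ]
    (h : ∀ i, μ.map (flipAt i) = μ) : μ = fair κ := by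
  refine Measure.eq_infinitePi _ fun s t _ => ?_
  induction s using Finset.induction_on with
  | empty => simp
  | insert i s hi ih =>
    have hm : ∀ s : Finset κ, MeasurableSet ((s : Set κ).pi t) := fun s =>
      MeasurableSet.pi s.countable_toSet fun _ _ => (Set.toFinite _).measurableSet
    set S := (s : Set κ).pi t with hS
    have hI : ((insert i s : Finset κ) : Set κ).pi t = {ω | ω i ∈ t i} ∩ S := by
      ext ω; simp [hS, Set.mem_pi]
    have hinv : ∀ b, flipAt i ⁻¹' ({ω | ω i = b} ∩ S) = {ω | ω i = !b} ∩ S := by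
      intro b
      ext ω
      simp only [Set.mem_preimage, Set.mem_inter_iff, Set.mem_ofPred_eq, flipAt_same, hS,
        Set.mem_pi, Finset.mem_coe]
      refine and_congr (by cases b <;> simp) (forall₂_congr fun j hj => ?_)
      rw [flipAt_ne (ne_of_mem_of_not_mem hj hi)]
    have hmb : ∀ b, MeasurableSet ({ω : κ → Bool | ω i = b}) := fun b =>
      measurableSet_coin i b
    -- Turning coin `i` exchanges the two halves of `S`, which does not involve that coin.
    have heq : μ ({ω | ω i = true} ∩ S) = μ ({ω | ω i = false} ∩ S) := by
      conv_lhs => rw [← h i]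
      rw [Measure.map_apply (measurable_flipAt i) ((hmb _).inter (hm s)), hinv]
      simp
    have hsum : μ ({ω | ω i = true} ∩ S) + μ ({ω | ω i = false} ∩ S) = μ S := by
      rw [← measure_inter_add_sdiff S (hmb true), Set.inter_comm]
      congr 2
      ext ω; simp [and_comm]
    have hhalf : ∀ b, μ ({ω | ω i = b} ∩ S) = 2⁻¹ * μ S := by
      have : μ ({ω | ω i = true} ∩ S) = 2⁻¹ * μ S := by
        rw [← hsum, ← heq, ← two_mul, ← mul_assoc, ENNReal.inv_mul_cancel (by simp) (by simp),
          one_mul]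
      intro b; cases b
      · rw [← heq, this]
      · exact this
    rw [Finset.prod_insert hi, ← ih, hI]
    by_cases h1 : true ∈ t i <;> by_cases h2 : false ∈ t i
    · have : t i = Set.univ := by ext b; cases b <;> simp [h1, h2]
      simp [this]
    · have : t i = {true} := by ext b; cases b <;> simp [h1, h2]
      rw [this, coin_singleton]; exact hhalf true
    · have : t i = {false} := by ext b; cases b <;> simp [h1, h2]
      rw [this, coin_singleton]; exact hhalf false
    · have : t i = ∅ := by ext b; cases b <;> simp [h1, h2]
      simp [this]

/-- Since `flipAt i` is a measurable involution, no measurability of `A` is needed. This allows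
later independence statements for events about followers without proving them measurable. -/
theorem fair_preimage_flipAt (i : κ) (A : Set (κ → Bool)) :
    fair κ (flipAt i ⁻¹' A) = fair κ A := by
  have hmp : MeasurePreserving (flipAt i) (fair κ) (fair κ) :=
    ⟨measurable_flipAt i, fair_map_flipAt i⟩
  let e : (κ → Bool) ≃ᵐ (κ → Bool) :=
    { toFun := flipAt i, invFun := flipAt i, left_inv := flipAt_flipAt i,
      right_inv := flipAt_flipAt i, measurable_toFun := measurable_flipAt i,
      measurable_invFun := measurable_flipAt i }
  exact hmp.measure_preimage_emb e.measurableEmbedding A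

/-- A prescribed outcome of finitely many coins, together with an event that does not depend on
these coins. -/
theorem fair_cylinder_inter (I : Finset κ) (v : κ → Bool) (C : Set (κ → Bool))
    (hC : ∀ i ∈ I, ∀ ω ∈ C, flipAt i ω ∈ C) :
    fair κ ({ω | ∀ i ∈ I, ω i = v i} ∩ C) = 2⁻¹ ^ I.card * fair κ C := by
  induction I using Finset.induction_on with
  | empty => simp
  | insert i s hi ih =>
    set S := {ω : κ → Bool | ∀ j ∈ s, ω j = v j} ∩ C with hS
    have hflip : ∀ ω ∈ S, flipAt i ω ∈ S := by
      rintro ω ⟨h1, h2⟩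
      refine ⟨fun j hj => ?_, hC i (by simp) ω h2⟩
      rw [flipAt_ne (ne_of_mem_of_not_mem hj hi)]; exact h1 j hj
    have hI : {ω | ∀ j ∈ insert i s, ω j = v j} ∩ C = {ω | ω i = v i} ∩ S := by
      ext ω; simp [hS, and_assoc]
    have hpre : flipAt i ⁻¹' (S ∩ {ω | ω i = v i}) = S \ {ω | ω i = v i} := by
      ext ω
      simp only [Set.mem_preimage, Set.mem_inter_iff, Set.mem_ofPred_eq, flipAt_same, Set.mem_sdiff]
      refine and_congr ⟨fun h => ?_, hflip ω⟩ (by cases ω i <;> cases v i <;> simp)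
      rw [← flipAt_flipAt i ω]; exact hflip _ h
    have hsum := measure_inter_add_sdiff (μ := fair κ) S (measurableSet_coin i (v i))
    rw [← hpre, fair_preimage_flipAt, ← two_mul] at hsum
    rw [hI, Finset.card_insert_of_notMem hi, pow_succ', mul_assoc,
      ← ih (fun j hj => hC j (Finset.mem_insert_of_mem hj)), ← hsum, ← mul_assoc,
      ENNReal.inv_mul_cancel (by simp) (by simp), one_mul, Set.inter_comm]

theorem fair_cylinder (I : Finset κ) (v : κ → Bool) :
    fair κ {ω | ∀ i ∈ I, ω i = v i} = 2⁻¹ ^ I.card := by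
  simpa using fair_cylinder_inter I v Set.univ (by simp)

/-- Events that depend on disjoint sets of coins are independent. -/
theorem fair_inter {I : Finset κ} {B : Set (κ → Bool)} (hB : DepOn (I : Set κ) B)
    (C : Set (κ → Bool)) (hC : ∀ i ∈ I, ∀ ω ∈ C, flipAt i ω ∈ C) :
    fair κ (B ∩ C) = fair κ B * fair κ C := by
  classical
  have hfin : (I.restrict '' B : Set (I → Bool)).Finite := Set.toFinite _
  have hmeas : ∀ y : I → Bool,
      MeasurableSet ((I.restrict : (κ → Bool) → I → Bool) ⁻¹' {y}) := fun y =>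
    (measurable_pi_lambda _ fun i => measurable_pi_apply _) (measurableSet_singleton y)
  have hpre : ∀ y : I → Bool, (I.restrict : (κ → Bool) → I → Bool) ⁻¹' {y}
      = {ω | ∀ i ∈ I, ω i = if h : i ∈ I then y ⟨i, h⟩ else true} := by
    intro y; ext ω
    simp only [Set.mem_preimage, Set.mem_singleton_iff, Set.mem_ofPred_eq]
    constructor
    · rintro rfl i hi; simp [hi]
    · intro h; funext i; simpa using h i i.2
  -- `B` is a finite union of patterns on `I`, each contributing the same factor; taking `D` to be
  -- everything identifies the total factor as the probability of `B`.
  have key : ∀ (D : Set (κ → Bool)), (∀ i ∈ I, ∀ ω ∈ D, flipAt i ω ∈ D) →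
      fair κ (B ∩ D) = hfin.toFinset.card * 2⁻¹ ^ I.card * fair κ D := by
    intro D hD
    have h1 := sum_measure_preimage_singleton (μ := (fair κ).restrict D) hfin.toFinset
      (f := (I.restrict : (κ → Bool) → I → Bool)) (fun y _ => hmeas y)
    rw [hfin.coe_toFinset, hB.preimage_restrict, Measure.restrict_apply hB.measurableSet] at h1
    rw [← h1, Finset.sum_congr rfl (g := fun _ => 2⁻¹ ^ I.card * fair κ D)]
    · rw [Finset.sum_const, nsmul_eq_mul, mul_assoc]
    · intro y _
      rw [Measure.restrict_apply (hmeas y), hpre, fair_cylinder_inter I _ D hD]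
  rw [key C hC]
  congr 1
  have := key Set.univ (by simp)
  simpa using this.symm

end Flip

/-- Selecting different coins, some of them turned, gives independent fair coins. -/
theorem fair_map_select {κ κ' : Type} (j : κ' → κ) (hj : Function.Injective j) (g : κ' → Bool) :
    (fair κ).map (fun ω i => xor (ω (j i)) (g i)) = fair κ' := by
  classical
  have hm : Measurable (fun (ω : κ → Bool) i => xor (ω (j i)) (g i)) :=
    measurable_pi_lambda _ fun i =>
      (measurable_of_finite fun b : Bool => xor b (g i)).comp (measurable_pi_apply (j i))
  have : IsProbabilityMeasure ((fair κ).map (fun ω i => xor (ω (j i)) (g i))) :=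
    Measure.isProbabilityMeasure_map hm.aemeasurable
  refine eq_fair_of_flip fun i => ?_
  rw [Measure.map_map (measurable_flipAt i) hm]
  conv_rhs => rw [← fair_map_flipAt (j i), Measure.map_map hm (measurable_flipAt _)]
  congr 1
  funext ω k
  by_cases hk : k = i
  · subst hk; simp [flipAt]
  · simp [flipAt, hk, hj.ne hk]

theorem fair_prod_map (α β : Type) :
    ((fair α).prod (fair β)).map (fun p => Sum.elim p.1 p.2) = fair (α ⊕ β) := by
  classical
  have hm : Measurable (fun p : (α → Bool) × (β → Bool) => (Sum.elim p.1 p.2 : α ⊕ β → Bool)) := by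
    refine measurable_pi_lambda _ fun i => ?_
    cases i with
    | inl a => exact (measurable_pi_apply a).comp measurable_fst
    | inr b => exact (measurable_pi_apply b).comp measurable_snd
  have : IsProbabilityMeasure (((fair α).prod (fair β)).map fun p => Sum.elim p.1 p.2) :=
    Measure.isProbabilityMeasure_map hm.aemeasurable
  refine eq_fair_of_flip fun i => ?_
  rw [Measure.map_map (measurable_flipAt i) hm]
  cases i with
  | inl a =>
    conv_rhs => rw [← fair_map_flipAt a]
    conv_rhs => rw [← Measure.map_id (μ := fair β),
      Measure.map_prod_map _ _ (measurable_flipAt a) measurable_id,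
      Measure.map_map hm ((measurable_flipAt a).prodMap measurable_id)]
    congr 1
    funext p k
    cases k <;> simp [flipAt]
  | inr b =>
    conv_rhs => rw [← fair_map_flipAt b]
    conv_rhs => rw [← Measure.map_id (μ := fair α),
      Measure.map_prod_map _ _ measurable_id (measurable_flipAt b),
      Measure.map_map hm (measurable_id.prodMap (measurable_flipAt b))]
    congr 1
    funext p k
    cases k <;> simp [flipAt]

/-! ### The simple random walk driven by fair coins -/

/-- The displacement that belongs to a coin. -/
def st (b : Bool) : ℤ := if b then 1 else -1

/-- The path that starts at `z` and moves according to the coins `s`. -/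
def pos (z : ℤ) (s : ℕ → Bool) : ℕ → ℤ
  | 0 => z
  | i + 1 => pos z s i + st (s i)

/-- Forget the first `n` coins. -/
def shift (n : ℕ) (s : ℕ → Bool) : ℕ → Bool := fun i => s (n + i)

@[simp] theorem st_true : st true = 1 := rfl
@[simp] theorem st_false : st false = -1 := rfl
@[simp] theorem pos_zero (z : ℤ) (s : ℕ → Bool) : pos z s 0 = z := rfl
theorem pos_succ (z : ℤ) (s : ℕ → Bool) (i : ℕ) : pos z s (i + 1) = pos z s i + st (s i) := rfl

theorem st_eq_or (b : Bool) : st b = 1 ∨ st b = -1 := by cases b <;> simp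

theorem pos_add (z : ℤ) (s : ℕ → Bool) (n m : ℕ) :
    pos z s (n + m) = pos (pos z s n) (shift n s) m := by
  induction m with
  | zero => simp
  | succ m ih => rw [← add_assoc, pos_succ, pos_succ, ih, shift]

theorem pos_congr (z : ℤ) {s s' : ℕ → Bool} {n : ℕ} (h : ∀ i < n, s i = s' i) :
    pos z s n = pos z s' n := by
  induction n with
  | zero => simp
  | succ n ih => rw [pos_succ, pos_succ, ih fun i hi => h i (by omega), h n (by omega)]

theorem pos_eq_add (z : ℤ) (s : ℕ → Bool) (n : ℕ) : pos z s n = z + pos 0 s n := by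
  induction n with
  | zero => simp
  | succ n ih => rw [pos_succ, pos_succ, ih]; ring

theorem abs_pos_sub_le (z : ℤ) (s : ℕ → Bool) (n : ℕ) : |pos z s n - z| ≤ n := by
  induction n with
  | zero => simp
  | succ n ih =>
    rw [pos_succ]; push_cast
    rw [abs_le] at ih ⊢
    rcases st_eq_or (s n) with h | h <;> rw [h] <;> constructor <;> linarith [ih.1, ih.2]

theorem measurable_pos (z : ℤ) (n : ℕ) : Measurable fun s : ℕ → Bool => pos z s n := by
  induction n with
  | zero => exact measurable_const
  | succ n ih =>
    exact ih.add ((measurable_of_finite st).comp (measurable_pi_apply n))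

theorem measurable_shift (n : ℕ) : Measurable (shift n) :=
  measurable_pi_lambda _ fun i => measurable_pi_apply (n + i)

theorem fair_map_shift (n : ℕ) : (fair ℕ).map (shift n) = fair ℕ := by
  have := fair_map_select (fun i : ℕ => n + i) (add_right_injective n) (fun _ => false)
  simp only [Bool.xor_false] at this
  exact this

theorem fair_preimage_shift (n : ℕ) {C : Set (ℕ → Bool)} (hC : MeasurableSet C) :
    fair ℕ (shift n ⁻¹' C) = fair ℕ C := by
  rw [← Measure.map_apply (measurable_shift n) hC, fair_map_shift]

theorem fair_preimage_shift_le (n : ℕ) (C : Set (ℕ → Bool)) :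
    fair ℕ (shift n ⁻¹' C) ≤ fair ℕ C := by
  conv_rhs => rw [← fair_map_shift n]
  exact Measure.le_map_apply (measurable_shift n).aemeasurable C

/-- The Markov property: the future is independent of the past. -/
theorem fair_past_future {n : ℕ} {B : Set (ℕ → Bool)} (hB : DepOn (Finset.range n : Set ℕ) B)
    (C : Set (ℕ → Bool)) :
    fair ℕ (B ∩ shift n ⁻¹' C) = fair ℕ B * fair ℕ (shift n ⁻¹' C) := by
  refine fair_inter hB _ fun i hi s hs => ?_
  have : shift n (flipAt i s) = shift n s := by
    funext k
    rw [Finset.mem_range] at hi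
    exact flipAt_ne (by omega) s
  simpa [this] using hs

theorem fair_first_step (E : Bool → Set (ℕ → Bool)) (hE : ∀ b, MeasurableSet (E b)) :
    fair ℕ {s | shift 1 s ∈ E (s 0)} = 2⁻¹ * fair ℕ (E true) + 2⁻¹ * fair ℕ (E false) := by
  have hdep : ∀ b, DepOn (Finset.range 1 : Set ℕ) {s : ℕ → Bool | s 0 = b} := by
    intro b s s' h hs
    simpa [h 0 (by simp)] using hs
  have hc : ∀ b, fair ℕ {s : ℕ → Bool | s 0 = b} = 2⁻¹ := by
    intro b
    simpa using fair_cylinder {0} (fun _ : ℕ => b)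
  have key : ∀ b, fair ℕ ({s | s 0 = b} ∩ shift 1 ⁻¹' (E b)) = 2⁻¹ * fair ℕ (E b) := by
    intro b
    rw [fair_past_future (hdep b), hc, fair_preimage_shift 1 (hE b)]
  rw [← measure_inter_add_sdiff _ (measurableSet_coin 0 true), ← key true, ← key false]
  congr 2
  · ext s
    simp only [Set.mem_inter_iff, Set.mem_ofPred_eq, Set.mem_preimage]
    constructor
    · rintro ⟨h1, h2⟩; rw [h2] at h1; exact ⟨h2, h1⟩
    · rintro ⟨h1, h2⟩; rw [h1]; exact ⟨h2, rfl⟩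
  · ext s
    simp only [Set.mem_inter_iff, Set.mem_ofPred_eq, Set.mem_preimage, Set.mem_sdiff,
      Bool.not_eq_true]
    constructor
    · rintro ⟨h1, h2⟩; rw [h2] at h1; exact ⟨h2, h1⟩
    · rintro ⟨h1, h2⟩; rw [h1]; exact ⟨h2, rfl⟩

theorem pos_succ' (z : ℤ) (s : ℕ → Bool) (i : ℕ) :
    pos z s (i + 1) = pos (z + st (s 0)) (shift 1 s) i := by
  rw [add_comm, pos_add]; rfl

theorem fairReal_first_step (E : Bool → Set (ℕ → Bool)) (hE : ∀ b, MeasurableSet (E b)) :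
    (fair ℕ).real {s | shift 1 s ∈ E (s 0)}
      = ((fair ℕ).real (E true) + (fair ℕ).real (E false)) / 2 := by
  simp only [measureReal_def]
  rw [fair_first_step E hE, ENNReal.toReal_add (by finiteness) (by finiteness)]
  simp; ring

/-! ### Recurrence -/

/-- The recursion makes `a` affine; the upper bound excludes a positive slope and nonnegativity a
negative one. -/
theorem eq_one_of_harmonic {a : ℕ → ℝ} (h0 : a 0 = 1) (hle : ∀ k, a k ≤ 1) (hge : ∀ k, 0 ≤ a k)
    (h : ∀ k, a (k + 1) = (a k + a (k + 2)) / 2) (k : ℕ) : a k = 1 := by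
  have hlin : ∀ k, a k = 1 + k * (a 1 - 1) ∧ a (k + 1) = 1 + (k + 1) * (a 1 - 1) := by
    intro k
    induction k with
    | zero => simp [h0]
    | succ k ih =>
      refine ⟨by push_cast; exact ih.2, ?_⟩
      have := h k
      push_cast
      linarith [ih.1, ih.2]
  have h1 : a 1 = 1 := by
    by_contra hne
    have hlt : a 1 < 1 := lt_of_le_of_ne (hle 1) hne
    obtain ⟨n, hn⟩ := exists_nat_gt (1 / (1 - a 1))
    rw [div_lt_iff₀ (by linarith)] at hn
    linarith [hge n, (hlin n).1]
  rw [(hlin k).1, h1]; ring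

theorem measurableSet_hits (y z : ℤ) : MeasurableSet {s : ℕ → Bool | ∃ n, pos y s n = z} := by
  have : {s : ℕ → Bool | ∃ n, pos y s n = z} = ⋃ n, {s | pos y s n = z} := by ext; simp
  rw [this]
  exact MeasurableSet.iUnion fun n => measurableSet_eq_fun (measurable_pos y n) measurable_const

theorem hits_harmonic {y : ℤ} (hy : y ≠ 0) :
    (fair ℕ).real {s : ℕ → Bool | ∃ n, pos y s n = 0}
      = ((fair ℕ).real {s : ℕ → Bool | ∃ n, pos (y + 1) s n = 0}
        + (fair ℕ).real {s : ℕ → Bool | ∃ n, pos (y - 1) s n = 0}) / 2 := by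
  have := fairReal_first_step (fun b => {s | ∃ n, pos (y + st b) s n = 0})
    fun b => measurableSet_hits _ _
  rw [st_true, st_false] at this
  rw [sub_eq_add_neg, ← this]
  congr 1
  ext s
  simp only [Set.mem_ofPred_eq]
  constructor
  · rintro ⟨n, hn⟩
    cases n with
    | zero => exact absurd hn hy
    | succ n => exact ⟨n, by rw [← hn, pos_succ']⟩
  · rintro ⟨n, hn⟩
    exact ⟨n + 1, by rw [pos_succ', hn]⟩

theorem hits_real_eq_one (y : ℤ) : (fair ℕ).real {s : ℕ → Bool | ∃ n, pos y s n = 0} = 1 := by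
  have hz : (fair ℕ).real {s : ℕ → Bool | ∃ n, pos 0 s n = 0} = 1 := by
    have : {s : ℕ → Bool | ∃ n, pos 0 s n = 0} = Set.univ := by
      ext s; simp only [Set.mem_ofPred_eq, Set.mem_univ, iff_true]; exact ⟨0, rfl⟩
    simp [this]
  have h1 : ∀ k : ℕ, (fair ℕ).real {s : ℕ → Bool | ∃ n, pos (k : ℤ) s n = 0} = 1 := by
    refine eq_one_of_harmonic (by simpa using hz) (fun k => measureReal_le_one)
      (fun k => measureReal_nonneg) fun k => ?_
    have e1 : ((k + 1 : ℕ) : ℤ) + 1 = ((k + 2 : ℕ) : ℤ) := by push_cast; ring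
    have e2 : ((k + 1 : ℕ) : ℤ) - 1 = (k : ℤ) := by push_cast; ring
    rw [hits_harmonic (by omega), e1, e2, add_comm]
  have h2 : ∀ k : ℕ, (fair ℕ).real {s : ℕ → Bool | ∃ n, pos (-(k : ℤ)) s n = 0} = 1 := by
    refine eq_one_of_harmonic (by simpa using hz) (fun k => measureReal_le_one)
      (fun k => measureReal_nonneg) fun k => ?_
    have e1 : -((k + 1 : ℕ) : ℤ) + 1 = -(k : ℤ) := by push_cast; ring
    have e2 : -((k + 1 : ℕ) : ℤ) - 1 = -((k + 2 : ℕ) : ℤ) := by push_cast; ring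
    rw [hits_harmonic (by omega), e1, e2]
  obtain ⟨k, rfl | rfl⟩ := y.eq_nat_or_neg
  · exact h1 k
  · exact h2 k

theorem ae_hits (y z : ℤ) : ∀ᵐ s ∂fair ℕ, ∃ n, pos y s n = z := by
  have h := hits_real_eq_one (y - z)
  have h' : fair ℕ {s : ℕ → Bool | ∃ n, pos y s n = z} = 1 := by
    rw [measureReal_def, ENNReal.toReal_eq_one_iff] at h
    rw [← h]
    congr 1
    ext s
    simp only [Set.mem_ofPred_eq]
    refine exists_congr fun n => ?_
    rw [pos_eq_add y, pos_eq_add (y - z)]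
    constructor <;> intro h <;> linarith
  rw [prob_compl_eq_zero_iff (measurableSet_hits y z) |>.symm] at h'
  exact h'

/-- The walk visits every point at arbitrarily late times. -/
theorem ae_hits_after (y z : ℤ) (n : ℕ) : ∀ᵐ s ∂fair ℕ, ∃ m, n ≤ m ∧ pos y s m = z := by
  have h : ∀ᵐ s ∂fair ℕ, ∀ w : ℤ, ∃ m, pos w (shift n s) m = z := by
    rw [ae_all_iff]
    intro w
    have := ae_hits w z
    rw [← fair_map_shift n] at this
    exact ae_of_ae_map (measurable_shift n).aemeasurable this
  filter_upwards [h] with s hs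
  obtain ⟨m, hm⟩ := hs (pos y s n)
  exact ⟨n + m, by omega, by rw [pos_add, hm]⟩

/-! ### Confinement to an interval -/

theorem measurableSet_confined (a z : ℤ) (m : ℕ) :
    MeasurableSet {s : ℕ → Bool | ∀ k ≤ m, |pos z s k| < a} := by
  have : {s : ℕ → Bool | ∀ k ≤ m, |pos z s k| < a}
      = ⋂ k ∈ Set.Iic m, (fun s => pos z s k) ⁻¹' {w : ℤ | |w| < a} := by
    ext; simp
  rw [this]
  exact MeasurableSet.biInter (Set.to_countable _) fun k _ =>
    measurable_pos z k (MeasurableSet.of_discrete)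

/-- Averaging the weight `2 * a ^ 2 - z ^ 2` over the two neighbors of `z` lowers it by exactly `1`,
which is at least the fraction `1 / (2 * a ^ 2)` of its value. On the interval the weight is at
least `a ^ 2`, which starts the induction. -/
theorem confined_le_quadratic (a : ℕ) (ha : 1 ≤ a) (m : ℕ) (z : ℤ) (hz : |z| ≤ a) :
    (fair ℕ).real {s : ℕ → Bool | ∀ k ≤ m, |pos z s k| < a} * (a : ℝ) ^ 2
      ≤ (2 * (a : ℝ) ^ 2 - (z : ℝ) ^ 2) * (1 - 1 / (2 * (a : ℝ) ^ 2)) ^ m := by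
  have ha' : (1 : ℝ) ≤ a := by exact_mod_cast ha
  have hzsq : ∀ z : ℤ, |z| ≤ a → (z : ℝ) ^ 2 ≤ (a : ℝ) ^ 2 := by
    intro z hz
    rw [sq_le_sq, abs_of_nonneg (by positivity : (0 : ℝ) ≤ a)]
    exact_mod_cast hz
  have hr0 : (0 : ℝ) ≤ 1 - 1 / (2 * (a : ℝ) ^ 2) := by
    rw [sub_nonneg, div_le_one (by positivity)]; nlinarith
  induction m generalizing z with
  | zero =>
    have h1 : (fair ℕ).real {s : ℕ → Bool | ∀ k ≤ 0, |pos z s k| < a} ≤ 1 := measureReal_le_one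
    have := hzsq z hz
    nlinarith
  | succ m ih =>
    by_cases hlt : |z| < a
    · have hstep := fairReal_first_step
        (fun b => {s : ℕ → Bool | ∀ k ≤ m, |pos (z + st b) s k| < a})
        fun b => measurableSet_confined _ _ _
      have hset : {s : ℕ → Bool | ∀ k ≤ m + 1, |pos z s k| < a}
          = {s | shift 1 s ∈ (fun b => {s : ℕ → Bool | ∀ k ≤ m, |pos (z + st b) s k| < a})
              (s 0)} := by
        ext s
        simp only [Set.mem_ofPred_eq]
        constructor
        · intro h k hk
          rw [← pos_succ']; exact h (k + 1) (by omega)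
        · intro h k hk
          cases k with
          | zero => simpa using hlt
          | succ k => rw [pos_succ']; exact h k (by omega)
      rw [hset, hstep, st_true, st_false]
      rw [abs_lt] at hlt
      have i1 := ih (z + 1) (by rw [abs_le]; constructor <;> linarith)
      have i2 := ih (z + -1) (by rw [abs_le]; constructor <;> linarith)
      push_cast at i1 i2
      set r := 1 - 1 / (2 * (a : ℝ) ^ 2) with hr
      have hrm : 0 ≤ r ^ m := pow_nonneg hr0 m
      have hsq := hzsq z hz
      have h3 : 2 * (a : ℝ) ^ 2 - (z : ℝ) ^ 2 - 1 ≤ (2 * (a : ℝ) ^ 2 - (z : ℝ) ^ 2) * r := by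
        have : (2 * (a : ℝ) ^ 2 - (z : ℝ) ^ 2) * (1 / (2 * (a : ℝ) ^ 2)) ≤ 1 := by
          rw [mul_one_div, div_le_one (by positivity)]; nlinarith [sq_nonneg (z : ℝ)]
        rw [hr]; linarith
      have h4 := mul_le_mul_of_nonneg_right h3 hrm
      have hpow : (2 * (a : ℝ) ^ 2 - (z : ℝ) ^ 2) * r ^ (m + 1)
          = (2 * (a : ℝ) ^ 2 - (z : ℝ) ^ 2) * r * r ^ m := by rw [pow_succ' r m]; ring
      have h5 : ((2 * (a : ℝ) ^ 2 - ((z : ℝ) + 1) ^ 2) * r ^ m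
          + (2 * (a : ℝ) ^ 2 - ((z : ℝ) + -1) ^ 2) * r ^ m) / 2
          = (2 * (a : ℝ) ^ 2 - (z : ℝ) ^ 2 - 1) * r ^ m := by ring
      rw [hpow]
      linarith
    · have hempty : {s : ℕ → Bool | ∀ k ≤ m + 1, |pos z s k| < a} = ∅ := by
        ext s
        simp only [Set.mem_ofPred_eq, Set.mem_empty_iff_false, iff_false]
        exact fun h => hlt (by simpa using h 0 (by omega))
      rw [hempty, measureReal_empty, zero_mul]
      have := hzsq z hz
      exact mul_nonneg (by nlinarith) (pow_nonneg hr0 _)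

theorem confined_le (a : ℕ) (ha : 1 ≤ a) (m : ℕ) :
    (fair ℕ).real {s : ℕ → Bool | ∀ k ≤ m, |pos 0 s k| < a}
      ≤ 2 * Real.exp (-(m / (2 * (a : ℝ) ^ 2))) := by
  have ha' : (1 : ℝ) ≤ a := by exact_mod_cast ha
  have h := confined_le_quadratic a ha m 0 (by simp)
  have hr0 : (0 : ℝ) ≤ 1 - 1 / (2 * (a : ℝ) ^ 2) := by
    rw [sub_nonneg, div_le_one (by positivity)]; nlinarith
  have hr1 : (1 - 1 / (2 * (a : ℝ) ^ 2)) ^ m ≤ Real.exp (-(m / (2 * (a : ℝ) ^ 2))) := by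
    have h1 : 1 - 1 / (2 * (a : ℝ) ^ 2) ≤ Real.exp (-(1 / (2 * (a : ℝ) ^ 2))) := by
      linarith [Real.add_one_le_exp (-(1 / (2 * (a : ℝ) ^ 2)))]
    calc _ ≤ Real.exp (-(1 / (2 * (a : ℝ) ^ 2))) ^ m := pow_le_pow_left₀ hr0 h1 m
      _ = _ := by rw [← Real.exp_nat_mul]; congr 1; ring
  have h2 : (fair ℕ).real {s : ℕ → Bool | ∀ k ≤ m, |pos 0 s k| < a} * (a : ℝ) ^ 2
      ≤ (2 * Real.exp (-(m / (2 * (a : ℝ) ^ 2)))) * (a : ℝ) ^ 2 := by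
    refine h.trans ?_
    have hp : (0 : ℝ) ≤ (a : ℝ) ^ 2 := by positivity
    have := mul_le_mul_of_nonneg_left hr1 hp
    push_cast
    nlinarith
  exact le_of_mul_le_mul_right h2 (by positivity)

/-! ### Followers -/

/-- The symbol observed on crossing an edge. The edge from `z` to `z + 1` carries the bit `e z`;
crossed downwards, it shows the opposite bit. -/
def inc (e : ℤ → Bool) (z : ℤ) (b : Bool) : Bool := if b then e z else !e (z - 1)

/-- Some `n`-step path from `q` in the environment `e'` shows the same symbols as the path
with steps `s` from `z` in the environment `e`. -/
def Foll (e' e : ℤ → Bool) (z : ℤ) (s : ℕ → Bool) (q : ℤ) (n : ℕ) : Prop :=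
  ∃ τ : ℕ → Bool, ∀ i < n, inc e' (pos q τ i) (τ i) = inc e (pos z s i) (s i)

section Followers

variable {e' e : ℤ → Bool}

theorem Foll.mono {z : ℤ} {s : ℕ → Bool} {q : ℤ} {n m : ℕ} (h : Foll e' e z s q m) (hnm : n ≤ m) :
    Foll e' e z s q n :=
  let ⟨τ, hτ⟩ := h
  ⟨τ, fun i hi => hτ i (by omega)⟩

theorem Foll.congr {z : ℤ} {s s' : ℕ → Bool} {q : ℤ} {n : ℕ} (hs : ∀ i < n, s i = s' i)
    (h : Foll e' e z s q n) : Foll e' e z s' q n := by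
  obtain ⟨τ, hτ⟩ := h
  refine ⟨τ, fun i hi => ?_⟩
  rw [hτ i hi, hs i hi, pos_congr z fun k hk => hs k (by omega)]

theorem depOn_foll (e' e : ℤ → Bool) (z q : ℤ) (n : ℕ) :
    DepOn (Finset.range n : Set ℕ) {s | Foll e' e z s q n} :=
  fun _ _ h hs => Foll.congr (fun i hi => h i (by simpa using hi)) hs

theorem Foll.split {z : ℤ} {s : ℕ → Bool} {q : ℤ} {n m : ℕ} (h : Foll e' e z s q (n + m)) :
    ∃ q', |q' - q| ≤ n ∧ Foll e' e (pos z s n) (shift n s) q' m := by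
  obtain ⟨τ, hτ⟩ := h
  refine ⟨pos q τ n, abs_pos_sub_le q τ n, shift n τ, fun i hi => ?_⟩
  rw [← pos_add, ← pos_add]
  exact hτ (n + i) (by omega)

/-- Compactness: if every `q ∈ F` failed at some time, all would fail at the largest of these times.
It turns followers for each finite time into one starting point that serves for all times. -/
theorem exists_forall_of_antitone {F : Finset ℤ} {p : ℤ → ℕ → Prop}
    (hp : ∀ q n m, n ≤ m → p q m → p q n) (h : ∀ n, ∃ q ∈ F, p q n) : ∃ q ∈ F, ∀ n, p q n := by
  by_contra! hc
  choose! N hN using hc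
  obtain ⟨q, hq, hpq⟩ := h (F.sup N)
  exact hN q hq (hp q _ _ (Finset.le_sup hq) hpq)

/-- A follower that never fails can be continued from one of its positions at time `n`. -/
theorem foll_forall_split {z : ℤ} {s : ℕ → Bool} {q : ℤ} (h : ∀ n, Foll e' e z s q n) (n : ℕ) :
    ∃ q', |q' - q| ≤ n ∧ ∀ m, Foll e' e (pos z s n) (shift n s) q' m := by
  obtain ⟨q', hq', hm⟩ := exists_forall_of_antitone (F := Finset.Icc (q - n) (q + n))
    (p := fun q' m => Foll e' e (pos z s n) (shift n s) q' m) (fun _ _ _ hnm h => h.mono hnm)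
    fun m => by
      obtain ⟨q', h1, h2⟩ := (h (n + m)).split
      rw [abs_le] at h1
      exact ⟨q', by rw [Finset.mem_Icc]; constructor <;> linarith [h1.1, h1.2], h2⟩
  rw [Finset.mem_Icc] at hq'
  exact ⟨q', by rw [abs_le]; constructor <;> linarith [hq'.1, hq'.2], hm⟩

/-- If from some site followers are avoided with positive probability, then they are avoided
almost surely, by recurrence of the walk. -/
theorem foll_null {z₀ : ℤ} (h : fair ℕ {s | ∃ q, ∀ n, Foll e' e z₀ s q n} < 1) :
    fair ℕ {s | ∀ n, Foll e' e 0 s 0 n} = 0 := by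
  set K := {s | ∃ q, ∀ n, Foll e' e z₀ s q n} with hK
  set A : ℕ → Set (ℕ → Bool) := fun n => {s | Foll e' e 0 s 0 n} with hA
  set Par := {s | ∀ n, Foll e' e 0 s 0 n} with hPar
  have hAm : ∀ n, MeasurableSet (A n) := fun n => (depOn_foll e' e 0 0 n).measurableSet
  -- Decompose by the first visit to `z₀` after time `n₀`. A surviving follower is at some site then
  -- and follows the remaining walk from `z₀`, so the shifted walk lies in `K`, independently of the
  -- past.
  have hstep : ∀ n₀, fair ℕ Par ≤ fair ℕ K * fair ℕ (A n₀) := by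
    intro n₀
    set Hit : ℕ → Set (ℕ → Bool) := fun k =>
      {s | pos 0 s (n₀ + k) = z₀ ∧ ∀ j < k, pos 0 s (n₀ + j) ≠ z₀} with hHit
    have hdep : ∀ k, DepOn (Finset.range (n₀ + k) : Set ℕ) (A n₀ ∩ Hit k) := by
      rintro k s s' hss ⟨h1, h2, h3⟩
      have hss' : ∀ i < n₀ + k, s i = s' i := fun i hi => hss i (by simpa using hi)
      refine ⟨Foll.congr (fun i hi => hss' i (by omega)) h1, ?_, fun j hj => ?_⟩
      · rw [← pos_congr 0 hss']; exact h2
      · rw [← pos_congr 0 fun i hi => hss' i (by omega)]; exact h3 j hj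
    have hsub : fair ℕ Par ≤ fair ℕ (⋃ k, (A n₀ ∩ Hit k) ∩ shift (n₀ + k) ⁻¹' K) := by
      refine measure_mono_ae ?_
      filter_upwards [ae_hits_after 0 z₀ n₀] with s hs hpar
      have hpar' : ∀ n, Foll e' e 0 s 0 n := hpar
      have hs' : ∃ k, pos 0 s (n₀ + k) = z₀ := by
        obtain ⟨m, h1, h2⟩ := hs
        exact ⟨m - n₀, by rw [Nat.add_sub_cancel' h1, h2]⟩
      classical
      refine Set.mem_iUnion.2 ⟨Nat.find hs', ⟨hpar' n₀, Nat.find_spec hs',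
        fun j hj => Nat.find_min hs' hj⟩, ?_⟩
      obtain ⟨q', -, hq'⟩ := foll_forall_split hpar' (n₀ + Nat.find hs')
      rw [Nat.find_spec hs'] at hq'
      exact ⟨q', hq'⟩
    have hdisj : Pairwise (Function.onFun Disjoint fun k => A n₀ ∩ Hit k) := by
      intro k l hkl
      rw [Function.onFun, Set.disjoint_left]
      rintro s ⟨-, h1, h2⟩ ⟨-, h3, h4⟩
      rcases lt_or_gt_of_ne hkl with hlt | hlt
      · exact h4 k hlt h1
      · exact h2 l hlt h3
    calc fair ℕ Par ≤ ∑' k, fair ℕ ((A n₀ ∩ Hit k) ∩ shift (n₀ + k) ⁻¹' K) :=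
          hsub.trans (measure_iUnion_le _)
      _ ≤ ∑' k, fair ℕ K * fair ℕ (A n₀ ∩ Hit k) := by
          refine ENNReal.tsum_le_tsum fun k => ?_
          rw [fair_past_future (hdep k), mul_comm]
          exact mul_le_mul_left (fair_preimage_shift_le _ _) _
      _ = fair ℕ K * fair ℕ (⋃ k, A n₀ ∩ Hit k) := by
          rw [ENNReal.tsum_mul_left, measure_iUnion hdisj fun k => (hdep k).measurableSet]
      _ ≤ fair ℕ K * fair ℕ (A n₀) := by
          gcongr
          exact Set.iUnion_subset fun k => Set.inter_subset_left
  have hlim : Filter.Tendsto (fun n => fair ℕ K * fair ℕ (A n)) Filter.atTop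
      (nhds (fair ℕ K * fair ℕ Par)) := by
    have hP : Par = ⋂ n, A n := by ext; simp [hPar, hA]
    rw [hP]
    refine ENNReal.Tendsto.const_mul (tendsto_measure_iInter_atTop
      (fun n => (hAm n).nullMeasurableSet) (fun n m hnm s hs => Foll.mono hs hnm)
      ⟨0, by finiteness⟩) (Or.inr (by finiteness))
  -- The events `A n` decrease to `Par`; as `K` has probability less than `1`, the inequality forces
  -- `Par` to be null.
  have hle : fair ℕ Par ≤ fair ℕ K * fair ℕ Par := ge_of_tendsto' hlim hstep
  by_contra hne
  have : fair ℕ K * fair ℕ Par < 1 * fair ℕ Par :=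
    ENNReal.mul_lt_mul_left hne (by finiteness) h
  rw [one_mul] at this
  exact absurd hle (not_le.2 this)

end Followers

/-! ### Exit times -/

/-- The walk with steps `u` leaves the open interval `(-l, r)` at time `t`. -/
def IsExit (l r : ℤ) (u : ℕ → Bool) (t : ℕ) : Prop :=
  (∀ i < t, -l < pos 0 u i ∧ pos 0 u i < r) ∧ ¬(-l < pos 0 u t ∧ pos 0 u t < r)

theorem IsExit.congr {l r : ℤ} {u u' : ℕ → Bool} {t : ℕ} (hu : ∀ i < t, u i = u' i)
    (h : IsExit l r u t) : IsExit l r u' t := by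
  have hp : ∀ i ≤ t, pos 0 u i = pos 0 u' i := fun i hi =>
    pos_congr 0 fun k hk => hu k (by omega)
  refine ⟨fun i hi => ?_, ?_⟩
  · rw [← hp i hi.le]; exact h.1 i hi
  · rw [← hp t le_rfl]; exact h.2

theorem IsExit.unique {l r : ℤ} {u : ℕ → Bool} {t t' : ℕ} (h : IsExit l r u t)
    (h' : IsExit l r u t') : t = t' := by
  by_contra hne
  rcases lt_or_gt_of_ne hne with hlt | hlt
  · exact h.2 (h'.1 t hlt)
  · exact h'.2 (h.1 t' hlt)

theorem IsExit.mem_Icc {l r : ℤ} {u : ℕ → Bool} {t : ℕ} (h : IsExit l r u t) (hl : 0 ≤ l)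
    (hr : 0 ≤ r) : -l ≤ pos 0 u t ∧ pos 0 u t ≤ r := by
  cases t with
  | zero => simpa using ⟨hl, hr⟩
  | succ t =>
    have := h.1 t (by omega)
    rw [pos_succ]
    rcases st_eq_or (u t) with h | h <;> rw [h] <;> constructor <;> omega

theorem IsExit.lt {l r l' r' : ℤ} {u : ℕ → Bool} {t t' : ℕ} (h : IsExit l r u t)
    (h' : IsExit l' r' u t') (hl : 0 ≤ l) (hr : 0 ≤ r) (hl' : l < l') (hr' : r < r') : t < t' := by
  by_contra! hle
  have hm := h.mem_Icc hl hr
  rcases hle.lt_or_eq with hlt | rfl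
  · have := h.1 t' hlt
    exact h'.2 ⟨by linarith [this.1], by linarith [this.2]⟩
  · exact h'.2 ⟨by linarith [hm.1], by linarith [hm.2]⟩

theorem exists_isExit {l r : ℤ} {u : ℕ → Bool} {m : ℕ}
    (h : ∃ i ≤ m, ¬(-l < pos 0 u i ∧ pos 0 u i < r)) : ∃ t ≤ m, IsExit l r u t := by
  classical
  have h' : ∃ i, ¬(-l < pos 0 u i ∧ pos 0 u i < r) := h.imp fun _ h => h.2
  obtain ⟨i, hi, hi'⟩ := h
  exact ⟨Nat.find h', (Nat.find_min' h' hi').trans hi,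
    fun k hk => not_not.1 (Nat.find_min h' hk), Nat.find_spec h'⟩

/-! ### Corners of five coin sequences -/

/-- One of five coin sequences. -/
def row (ω : Fin 5 × ℕ → Bool) (k : Fin 5) : ℕ → Bool := fun i => ω (k, i)

/-- `t` collects the times at which the first four walks leave `(-j, j)`, and the time at which
the fifth walk leaves the interval that is bounded by the first two times. -/
def Lv (ω : Fin 5 × ℕ → Bool) (j : ℕ) (t : Fin 5 → ℕ) : Prop :=
  (∀ k : Fin 5, k ≠ 4 → IsExit j j (row ω k) (t k)) ∧ IsExit (t 1) (t 0) (row ω 4) (t 4)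

/-- Whether the next step after time `h` leads away from the origin. -/
def outc (u : ℕ → Bool) (h : ℕ) : Bool := u h == decide (0 < pos 0 u h)

/-- The first, second and fifth walk continue outwards, the other two turn back. -/
def Corner (ω : Fin 5 × ℕ → Bool) (t : Fin 5 → ℕ) : Prop :=
  ∀ k, outc (row ω k) (t k) = (![true, true, false, false, true] : Fin 5 → Bool) k

/-- There is no corner at the levels `1, …, j - 1`. -/
def NoCorner (ω : Fin 5 × ℕ → Bool) (j : ℕ) : Prop :=
  ∀ i, 1 ≤ i → i < j → ∀ t, Lv ω i t → ¬Corner ω t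

/-- The times of level `j` are smaller than `n`. -/
def Within (ω : Fin 5 × ℕ → Bool) (j n : ℕ) : Prop := ∃ t, Lv ω j t ∧ ∀ k, t k < n

theorem Lv.congr {ω ω' : Fin 5 × ℕ → Bool} {j : ℕ} {t : Fin 5 → ℕ}
    (hω : ∀ k, ∀ i < t k, ω (k, i) = ω' (k, i)) (h : Lv ω j t) : Lv ω' j t :=
  ⟨fun k hk => (h.1 k hk).congr (hω k), h.2.congr (hω 4)⟩

theorem Lv.unique {ω : Fin 5 × ℕ → Bool} {j : ℕ} {t t' : Fin 5 → ℕ} (h : Lv ω j t)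
    (h' : Lv ω j t') : t = t' := by
  have hk : ∀ k : Fin 5, k ≠ 4 → t k = t' k := fun k hk => (h.1 k hk).unique (h'.1 k hk)
  funext k
  by_cases h4 : k = 4
  · subst h4
    have h2 := h.2
    rw [hk 0 (by decide), hk 1 (by decide)] at h2
    exact h2.unique h'.2
  · exact hk k h4

theorem Lv.lt {ω : Fin 5 × ℕ → Bool} {i j : ℕ} {t t' : Fin 5 → ℕ} (h : Lv ω i t)
    (h' : Lv ω j t') (hij : i < j) (k : Fin 5) : t k < t' k := by
  have hk : ∀ k : Fin 5, k ≠ 4 → t k < t' k := fun k hk =>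
    (h.1 k hk).lt (h'.1 k hk) (by omega) (by omega) (by omega) (by omega)
  by_cases h4 : k = 4
  · subst h4
    have h0 := hk 0 (by decide)
    have h1 := hk 1 (by decide)
    exact h.2.lt h'.2 (by omega) (by omega) (by omega) (by omega)
  · exact hk k h4

/-- A corner at a lower level also reads the coins at its own exit times, but by `Lv.lt` these come
strictly before the exit times of level `j`. So the coins at the exit times of level `j` remain
fresh. -/
theorem NoCorner.congr {ω ω' : Fin 5 × ℕ → Bool} {j : ℕ} {t : Fin 5 → ℕ}
    (hω : ∀ k, ∀ i < t k, ω (k, i) = ω' (k, i)) (h : Lv ω j t) (hn : NoCorner ω j) :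
    NoCorner ω' j := by
  intro i hi hij t' ht' hc
  have hlt := ht'.lt (h.congr hω) hij
  refine hn i hi hij t' (ht'.congr fun k l hl => (hω k l (hl.trans (hlt k))).symm) fun k => ?_
  rw [← hc k, outc, outc, row, hω k _ (hlt k), pos_congr 0 (s := row ω k)
    (s' := row ω' k) fun l hl => hω k l (hl.trans (hlt k))]
  rfl

theorem NoCorner.mono {ω : Fin 5 × ℕ → Bool} {i j : ℕ} (h : NoCorner ω j) (hij : i ≤ j) :
    NoCorner ω i := fun l hl hli => h l hl (by omega)

theorem Within.of_succ {ω : Fin 5 × ℕ → Bool} {j n : ℕ} (h : Within ω (j + 1) n) :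
    Within ω j n := by
  obtain ⟨t, ht, hn⟩ := h
  have hk : ∀ k : Fin 5, k ≠ 4 → ∃ i ≤ t k, IsExit j j (row ω k) i := by
    intro k hk
    refine exists_isExit ⟨t k, le_rfl, fun hc => (ht.1 k hk).2 ?_⟩
    push_cast
    exact ⟨by linarith [hc.1], by linarith [hc.2]⟩
  choose! τ hτ hτ' using hk
  obtain ⟨t4, h4, h4'⟩ : ∃ i ≤ t 4, IsExit (τ 1) (τ 0) (row ω 4) i := by
    have h0 := hτ 0 (by decide)
    have h1 := hτ 1 (by decide)
    refine exists_isExit ⟨t 4, le_rfl, fun hc => ht.2.2 ?_⟩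
    constructor <;> omega
  refine ⟨Function.update τ 4 t4, ⟨fun k hk => ?_, ?_⟩, fun k => ?_⟩
  · rw [Function.update_of_ne hk]; exact hτ' k hk
  · simpa using h4'
  · by_cases hk : k = 4
    · subst hk; simpa using h4.trans_lt (hn 4)
    · rw [Function.update_of_ne hk]; exact (hτ k hk).trans_lt (hn k)

/-- The coins that decide about a corner are independent of the past. -/
theorem fair_corner (j n : ℕ) :
    fair (Fin 5 × ℕ) {ω | (NoCorner ω j ∧ Within ω j n) ∧ ∀ t, Lv ω j t → Corner ω t}
      = 2⁻¹ ^ 5 * fair (Fin 5 × ℕ) {ω | NoCorner ω j ∧ Within ω j n} := by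
  classical
  -- Split by the five exit times and the signs of the positions there. Each piece reads only coins
  -- before the exit times, and on it a corner prescribes exactly the five coins at these times.
  set C : (Fin 5 → Fin n) × (Fin 5 → Bool) → Set (Fin 5 × ℕ → Bool) := fun p =>
    {ω | NoCorner ω j ∧ Lv ω j (fun k => p.1 k) ∧
      ∀ k, decide (0 < pos 0 (row ω k) (p.1 k)) = p.2 k} with hC
  set I : (Fin 5 → Fin n) → Finset (Fin 5 × ℕ) := fun τ =>
    Finset.univ.image fun k => (k, (τ k : ℕ)) with hI
  have hcard : ∀ τ, (I τ).card = 5 := by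
    intro τ
    rw [hI, Finset.card_image_of_injective _ fun a b h => (Prod.ext_iff.1 h).1]; simp
  set v : (Fin 5 → Bool) → Fin 5 × ℕ → Bool := fun w p =>
    w p.1 == (![true, true, false, false, true] : Fin 5 → Bool) p.1 with hv
  have hagree : ∀ p, ∀ ω ω' : Fin 5 × ℕ → Bool,
      (∀ k, ∀ i < (p.1 k : ℕ), ω (k, i) = ω' (k, i)) → ω ∈ C p → ω' ∈ C p := by
    rintro p ω ω' h ⟨h1, h2, h3⟩
    refine ⟨h1.congr h h2, h2.congr h, fun k => ?_⟩
    rw [← h3 k, pos_congr 0 (s := row ω' k) (s' := row ω k) fun i hi => (h k i hi).symm]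
  have hdep : ∀ p, DepOn ((Finset.univ ×ˢ Finset.range n : Finset (Fin 5 × ℕ)) :
      Set (Fin 5 × ℕ)) (C p) := by
    intro p ω ω' h
    refine hagree p ω ω' fun k i hi => h (k, i) ?_
    have := (p.1 k).2
    simp; omega
  have hflip : ∀ p, ∀ i ∈ I p.1, ∀ ω ∈ C p, flipAt i ω ∈ C p := by
    intro p i hi ω
    simp only [hI, Finset.mem_image, Finset.mem_univ, true_and] at hi
    obtain ⟨k, rfl⟩ := hi
    refine hagree p _ _ fun l i hi => (flipAt_ne ?_ ω).symm
    rintro ⟨⟩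
    exact lt_irrefl _ hi
  have hX : ∀ p, {ω | ∀ i ∈ I p.1, ω i = v p.2 i} ∩ C p
      = {ω | ω ∈ C p ∧ ∀ t, Lv ω j t → Corner ω t} := by
    intro p
    ext ω
    simp only [Set.mem_inter_iff, Set.mem_ofPred_eq]
    rw [and_comm]
    refine and_congr_right fun hω => ?_
    have hb : ∀ a w t : Bool, a = (w == t) ↔ (a == w) = t := by decide
    have h1 : (∀ i ∈ I p.1, ω i = v p.2 i) ↔ Corner ω (fun k => p.1 k) := by
      simp only [hI, Finset.mem_image, Finset.mem_univ, true_and, forall_exists_index,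
        forall_apply_eq_imp_iff, Corner, outc]
      refine forall_congr' fun k => ?_
      rw [hω.2.2 k, hv, hb]; rfl
    rw [h1]
    constructor
    · intro h t ht; rw [← hω.2.1.unique ht]; exact h
    · exact fun h => h _ hω.2.1
  have hdisj : Pairwise (Function.onFun Disjoint C) := by
    intro p p' hne
    rw [Function.onFun, Set.disjoint_left]
    rintro ω ⟨-, h1, h2⟩ ⟨-, h3, h4⟩
    apply hne
    have h5 := h1.unique h3
    have h6 : p.1 = p'.1 := by funext k; exact Fin.ext (congrFun h5 k)
    refine Prod.ext h6 ?_
    funext k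
    rw [← h2 k, ← h4 k, h6]
  have hcov : {ω | NoCorner ω j ∧ Within ω j n} = ⋃ p, C p := by
    ext ω
    simp only [Set.mem_ofPred_eq, Set.mem_iUnion, hC]
    constructor
    · rintro ⟨h1, t, h2, h3⟩
      exact ⟨⟨fun k => ⟨t k, h3 k⟩, fun k => decide (0 < pos 0 (row ω k) (t k))⟩, h1, h2,
        fun k => rfl⟩
    · rintro ⟨p, h1, h2, -⟩
      exact ⟨h1, _, h2, fun k => (p.1 k).2⟩
  have hcov' : {ω | (NoCorner ω j ∧ Within ω j n) ∧ ∀ t, Lv ω j t → Corner ω t}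
      = ⋃ p, ({ω | ∀ i ∈ I p.1, ω i = v p.2 i} ∩ C p) := by
    ext ω
    have := Set.ext_iff.1 hcov ω
    simp only [Set.mem_ofPred_eq, Set.mem_iUnion] at this
    simp only [hX, Set.mem_ofPred_eq, Set.mem_iUnion, this, exists_and_right]
  rw [hcov, hcov', measure_iUnion hdisj fun p => (hdep p).measurableSet,
    measure_iUnion (fun p p' hne => (hdisj hne).mono Set.inter_subset_right Set.inter_subset_right),
    ← ENNReal.tsum_mul_left]
  · refine tsum_congr fun p => ?_
    rw [fair_cylinder_inter _ _ _ (hflip p), hcard]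
  · intro p
    refine MeasurableSet.inter ?_ (hdep p).measurableSet
    exact DepOn.measurableSet (I := I p.1) fun ω ω' h hω i hi => by
      rw [← h i hi]; exact hω i hi

theorem depOn_noCorner_within (j n : ℕ) :
    DepOn ((Finset.univ ×ˢ Finset.range n : Finset (Fin 5 × ℕ)) : Set (Fin 5 × ℕ))
      {ω | NoCorner ω j ∧ Within ω j n} := by
  rintro ω ω' h ⟨h1, t, h2, h3⟩
  have h' : ∀ k, ∀ i < t k, ω (k, i) = ω' (k, i) := fun k i hi => h (k, i) (by
    have := h3 k
    simp; omega)
  exact ⟨h1.congr h' h2, t, h2.congr h', h3⟩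

theorem depOn_within (j n : ℕ) :
    DepOn ((Finset.univ ×ˢ Finset.range n : Finset (Fin 5 × ℕ)) : Set (Fin 5 × ℕ))
      {ω | Within ω j n} := by
  rintro ω ω' h ⟨t, h2, h3⟩
  exact ⟨t, h2.congr fun k i hi => h (k, i) (by have := h3 k; simp; omega), h3⟩

/-- By `fair_corner` every further level retains at most the fraction `1 - 2⁻¹ ^ 5` of the event.
The restriction `Within` keeps all events dependent on finitely many coins. -/
theorem fair_noCorner_le (j n : ℕ) :
    (fair (Fin 5 × ℕ)).real {ω | NoCorner ω (j + 1) ∧ Within ω (j + 1) n} ≤ (31 / 32) ^ j := by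
  induction j with
  | zero => simp
  | succ j ih =>
    set A := {ω | NoCorner ω (j + 1) ∧ Within ω (j + 1) n} with hA
    set X := {ω | ω ∈ A ∧ ∀ t, Lv ω (j + 1) t → Corner ω t} with hX
    have hAm : MeasurableSet A := (depOn_noCorner_within (j + 1) n).measurableSet
    have hX' : (fair (Fin 5 × ℕ)).real X = (1 / 32) * (fair (Fin 5 × ℕ)).real A := by
      have := congrArg ENNReal.toReal (fair_corner (j + 1) n)
      have h32 : ((2⁻¹ : ℝ≥0∞) ^ 5).toReal = 1 / 32 := by
        rw [ENNReal.toReal_pow, ENNReal.toReal_inv]; norm_num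
      rw [ENNReal.toReal_mul, h32] at this
      exact this
    have hsub : {ω | NoCorner ω (j + 1 + 1) ∧ Within ω (j + 1 + 1) n} ∪ X ⊆ A := by
      rintro ω (⟨h1, h2⟩ | h)
      · exact ⟨h1.mono (by omega), h2.of_succ⟩
      · exact h.1
    have hdisj : Disjoint {ω | NoCorner ω (j + 1 + 1) ∧ Within ω (j + 1 + 1) n} X := by
      rw [Set.disjoint_left]
      rintro ω ⟨h1, h2⟩ ⟨⟨-, t, ht, -⟩, h⟩
      exact h1 (j + 1) (by omega) (by omega) t ht (h t ht)
    have hm := (depOn_noCorner_within (j + 1 + 1) n).measurableSet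
    have := measureReal_mono (μ := fair (Fin 5 × ℕ)) hsub
    rw [measureReal_union' hdisj hm, hX'] at this
    rw [pow_succ]
    linarith

theorem fair_row_confined_le (k : Fin 5) (a : ℕ) (ha : 1 ≤ a) (m : ℕ) :
    (fair (Fin 5 × ℕ)).real {ω | ∀ i ≤ m, |pos 0 (row ω k) i| < a}
      ≤ 2 * Real.exp (-(m / (2 * (a : ℝ) ^ 2))) := by
  refine le_of_eq_of_le ?_ (confined_le a ha m)
  have h := fair_map_select (κ := Fin 5 × ℕ) (fun i : ℕ => (k, i))
    (fun a b h => (Prod.ext_iff.1 h).2) (fun _ => false)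
  simp only [Bool.xor_false] at h
  have hm : Measurable fun ω : Fin 5 × ℕ → Bool => fun i => ω (k, i) :=
    measurable_pi_lambda _ fun i => measurable_pi_apply (k, i)
  rw [measureReal_def, measureReal_def, ← h, Measure.map_apply hm (measurableSet_confined _ _ _)]
  rfl

theorem within_of_exit {ω : Fin 5 × ℕ → Bool} {j m n : ℕ} (hmn : m < n)
    (h : ∀ k : Fin 5, k ≠ 4 → ∃ i ≤ m, j ≤ |pos 0 (row ω k) i|)
    (h4 : ∃ i < n, m ≤ |pos 0 (row ω 4) i|) : Within ω j n := by
  have hk : ∀ k : Fin 5, k ≠ 4 → ∃ i ≤ m, IsExit j j (row ω k) i := by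
    intro k hk
    obtain ⟨i, hi, hi'⟩ := h k hk
    exact exists_isExit ⟨i, hi, fun hc => absurd (abs_lt.2 hc) (not_lt.2 hi')⟩
  choose! τ hτ hτ' using hk
  obtain ⟨i, hi, hi'⟩ := h4
  obtain ⟨t4, h4, h4'⟩ : ∃ i ≤ n - 1, IsExit (τ 1) (τ 0) (row ω 4) i := by
    have h0 := hτ 0 (by decide)
    have h1 := hτ 1 (by decide)
    refine exists_isExit ⟨i, by omega, fun hc => absurd (abs_lt.2 ?_) (not_lt.2 hi')⟩
    constructor <;> omega
  refine ⟨Function.update τ 4 t4, ⟨fun k hk => ?_, ?_⟩, fun k => ?_⟩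
  · rw [Function.update_of_ne hk]; exact hτ' k hk
  · simpa using h4'
  · by_cases hk : k = 4
    · subst hk; simp; omega
    · rw [Function.update_of_ne hk]; exact (hτ k hk).trans_lt hmn

/-- The five sequences show no corner up to level `J` within time `J ^ 7`. -/
def BadRows (J : ℕ) : Set (Fin 5 × ℕ → Bool) :=
  {ω | Within ω J (J ^ 7 + 1) → NoCorner ω J}

theorem depOn_badRows (J : ℕ) :
    DepOn ((Finset.univ ×ˢ Finset.range (J ^ 7 + 1) : Finset (Fin 5 × ℕ)) : Set (Fin 5 × ℕ))
      (BadRows J) := by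
  intro ω ω' h hω hw
  have hw' := depOn_within J (J ^ 7 + 1) ω' ω (fun i hi => (h i hi).symm) hw
  exact (depOn_noCorner_within J (J ^ 7 + 1) ω ω' h ⟨hω hw', hw'⟩).1

/-- Either there is no corner although all exits are in time, or some exit is late. The heights
should leave `(-J, J)` within `J ^ 3` steps, and the walk an interval of radius at most `J ^ 3`
within `J ^ 7` steps; both exponents make the rate in `confined_le` equal to `J / 2`. -/
theorem fair_badRows_le (J : ℕ) (hJ : 2 ≤ J) :
    (fair (Fin 5 × ℕ)).real (BadRows J) ≤ 16 * (31 / 32) ^ J := by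
  have hsub : BadRows J ⊆ {ω | NoCorner ω (J - 1 + 1) ∧ Within ω (J - 1 + 1) (J ^ 7 + 1)} ∪
      ((⋃ k : Fin 5, {ω | ∀ i ≤ J ^ 3, |pos 0 (row ω k) i| < J}) ∪
        {ω | ∀ i ≤ J ^ 7, |pos 0 (row ω 4) i| < (J ^ 3 : ℕ)}) := by
    intro ω hω
    rw [Nat.sub_add_cancel (by omega)]
    by_cases hw : Within ω J (J ^ 7 + 1)
    · exact Or.inl ⟨hω hw, hw⟩
    · right
      by_contra hc
      simp only [Set.mem_union, Set.mem_iUnion, Set.mem_ofPred_eq, not_or, not_exists, not_forall,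
        not_lt] at hc
      obtain ⟨hc1, i, hi, hc2⟩ := hc
      refine hw (within_of_exit (m := J ^ 3) ?_ (fun k _ => ?_) ⟨i, by omega, hc2⟩)
      · exact Nat.lt_succ_of_le (Nat.pow_le_pow_right (by omega) (by omega))
      · obtain ⟨i, hi, h⟩ := hc1 k
        exact ⟨i, hi, h⟩
  have hJ' : (0 : ℝ) < J := by positivity
  have h1 : ∀ k, (fair (Fin 5 × ℕ)).real {ω | ∀ i ≤ J ^ 3, |pos 0 (row ω k) i| < J}
      ≤ 2 * Real.exp (-(J / 2)) := by
    intro k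
    refine (fair_row_confined_le k J (by omega) (J ^ 3)).trans (le_of_eq ?_)
    congr 3
    push_cast
    field_simp
  have h2 : (fair (Fin 5 × ℕ)).real {ω | ∀ i ≤ J ^ 7, |pos 0 (row ω 4) i| < (J ^ 3 : ℕ)}
      ≤ 2 * Real.exp (-(J / 2)) := by
    refine (fair_row_confined_le 4 (J ^ 3) (Nat.one_le_pow _ _ (by omega)) (J ^ 7)).trans
      (le_of_eq ?_)
    congr 3
    push_cast
    field_simp
  have h3 : (fair (Fin 5 × ℕ)).real (⋃ k : Fin 5, {ω | ∀ i ≤ J ^ 3, |pos 0 (row ω k) i| < J})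
      ≤ 10 * Real.exp (-(J / 2)) := by
    refine (measureReal_iUnion_fintype_le _).trans ((Finset.sum_le_sum fun k _ => h1 k).trans ?_)
    simp; linarith
  have h4 := fair_noCorner_le (J - 1) (J ^ 7 + 1)
  have h5 : Real.exp (-(J / 2)) ≤ (31 / 32) ^ J := by
    have : Real.exp (-(J / 2)) = Real.exp (-1 / 2) ^ J := by
      rw [← Real.exp_nat_mul]; congr 1; ring
    rw [this]
    refine pow_le_pow_left₀ (Real.exp_pos _).le ?_ J
    have h6 : Real.exp (1 / 2) * Real.exp (-1 / 2) = 1 := by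
      rw [← Real.exp_add]; norm_num
    have h7 := Real.add_one_le_exp (1 / 2 : ℝ)
    nlinarith [Real.exp_pos (-1 / 2 : ℝ)]
  have h8 : ((31 : ℝ) / 32) ^ (J - 1) ≤ 2 * (31 / 32) ^ J := by
    obtain ⟨i, rfl⟩ : ∃ i, J = i + 1 := ⟨J - 1, by omega⟩
    have : (0 : ℝ) < (31 / 32) ^ i := by positivity
    rw [Nat.add_sub_cancel, pow_succ]
    linarith
  have h9 : (0 : ℝ) < (31 / 32) ^ J := by positivity
  calc _ ≤ _ := measureReal_mono hsub
    _ ≤ _ := measureReal_union_le _ _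
    _ ≤ _ := add_le_add le_rfl (measureReal_union_le _ _)
    _ ≤ 16 * (31 / 32) ^ J := by linarith

/-! ### The potential of an environment -/

/-- The height of `z` over `b` when edge `z` is a step up or down according to `e z`. -/
def pot (e : ℤ → Bool) (b z : ℤ) : ℤ :=
  if b ≤ z then pos 0 (fun i : ℕ => e (b + i)) (z - b).toNat
  else pos 0 (fun i : ℕ => !e (b - 1 - i)) (b - z).toNat

theorem pot_add (e : ℤ → Bool) (b : ℤ) (i : ℕ) :
    pot e b (b + i) = pos 0 (fun i : ℕ => e (b + i)) i := by
  simp [pot]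

theorem pot_sub (e : ℤ → Bool) (b : ℤ) (i : ℕ) :
    pot e b (b - i) = pos 0 (fun i : ℕ => !e (b - 1 - i)) i := by
  rcases Nat.eq_zero_or_pos i with rfl | hi
  · simp [pot]
  · have : ¬b ≤ b - i := by omega
    simp [pot]; omega

theorem pot_self (e : ℤ → Bool) (b : ℤ) : pot e b b = 0 := by simp [pot]

theorem pot_succ (e : ℤ → Bool) (b z : ℤ) : pot e b (z + 1) = pot e b z + st (e z) := by
  rcases le_or_gt b z with h | h
  · obtain ⟨i, rfl⟩ : ∃ i : ℕ, z = b + i := ⟨(z - b).toNat, by omega⟩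
    have : b + (i : ℤ) + 1 = b + ((i + 1 : ℕ) : ℤ) := by push_cast; ring
    rw [this, pot_add, pot_add, pos_succ]
  · obtain ⟨i, rfl⟩ : ∃ i : ℕ, z = b - ((i + 1 : ℕ) : ℤ) := ⟨(b - z - 1).toNat, by omega⟩
    have h1 : b - ((i + 1 : ℕ) : ℤ) + 1 = b - i := by push_cast; ring
    have h2 : b - ((i + 1 : ℕ) : ℤ) = b - 1 - i := by push_cast; ring
    rw [h1, pot_sub, pot_sub, pos_succ, h2]
    cases e (b - 1 - i) <;> simp

/-- This is the reason for the negation in `inc`: in either direction the observed symbol is the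
increment of the height. -/
theorem pot_step (e : ℤ → Bool) (b z : ℤ) (c : Bool) :
    pot e b (z + st c) = pot e b z + st (inc e z c) := by
  cases c
  · have := pot_succ e b (z - 1)
    rw [sub_add_cancel] at this
    rw [st_false, ← sub_eq_add_neg, this, inc]
    cases e (z - 1) <;> simp
  · rw [st_true, pot_succ]; rfl

theorem pot_eq_of_foll {e' e : ℤ → Bool} {b q : ℤ} {s τ : ℕ → Bool} {n : ℕ}
    (h : ∀ i < n, inc e' (pos q τ i) (τ i) = inc e (pos b s i) (s i)) (i : ℕ) (hi : i ≤ n) :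
    pot e' q (pos q τ i) = pot e b (pos b s i) := by
  induction i with
  | zero => simp [pot_self]
  | succ i ih => rw [pos_succ, pos_succ, pot_step, pot_step, ih (by omega), h i (by omega)]

theorem IsExit.abs_eq {j : ℕ} {u : ℕ → Bool} {t : ℕ} (h : IsExit j j u t) :
    |pos 0 u t| = j := by
  have h1 := h.mem_Icc (by omega) (by omega)
  have h2 := h.2
  rcases abs_cases (pos 0 u t) with h3 | h3 <;> omega

theorem IsExit.one_le {j : ℕ} (hj : 1 ≤ j) {u : ℕ → Bool} {t : ℕ} (h : IsExit j j u t) :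
    1 ≤ t := by
  have := h.abs_eq
  rcases Nat.eq_zero_or_pos t with rfl | ht
  · simp at this; omega
  · exact ht

theorem IsExit.abs_succ_of_outc {j : ℕ} (hj : 1 ≤ j) {u : ℕ → Bool} {t : ℕ} (h : IsExit j j u t)
    (ho : outc u t = true) : |pos 0 u (t + 1)| = j + 1 := by
  have h1 := h.abs_eq
  rw [outc, beq_iff_eq] at ho
  rw [pos_succ, ho]
  rcases abs_cases (pos 0 u t) with h2 | h2
  · rw [decide_eq_true (by omega), st_true, abs_of_nonneg (by omega)]; omega
  · rw [decide_eq_false (by omega), st_false, abs_of_neg (by omega)]; omega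

theorem IsExit.abs_succ_le_of_outc {j : ℕ} (hj : 1 ≤ j) {u : ℕ → Bool} {t : ℕ}
    (h : IsExit j j u t) (ho : outc u t = false) : |pos 0 u (t + 1)| ≤ j := by
  have h1 := h.abs_eq
  rw [outc, beq_eq_false_iff_ne, ← Bool.eq_not] at ho
  rw [pos_succ, ho, abs_le]
  rcases abs_cases (pos 0 u t) with h2 | h2
  · rw [decide_eq_true (by omega), Bool.not_true, st_false]; omega
  · rw [decide_eq_false (by omega), Bool.not_false, st_true]; omega

section Exit

variable {e : ℤ → Bool} {b : ℤ} {j t₀ t₁ : ℕ}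

theorem abs_pot_lt (h₀ : IsExit j j (fun i : ℕ => e (b + i)) t₀)
    (h₁ : IsExit j j (fun i : ℕ => !e (b - 1 - i)) t₁) {z : ℤ} (hz : b - t₁ < z) (hz' : z < b + t₀) :
    |pot e b z| < j := by
  rcases le_or_gt b z with h | h
  · obtain ⟨i, rfl⟩ : ∃ i : ℕ, z = b + i := ⟨(z - b).toNat, by omega⟩
    rw [pot_add]
    exact abs_lt.2 (h₀.1 i (by omega))
  · obtain ⟨i, rfl⟩ : ∃ i : ℕ, z = b - i := ⟨(b - z).toNat, by omega⟩
    rw [pot_sub]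
    exact abs_lt.2 (h₁.1 i (by omega))

theorem abs_pot_right (h₀ : IsExit j j (fun i : ℕ => e (b + i)) t₀) : |pot e b (b + t₀)| = j := by
  rw [pot_add]; exact h₀.abs_eq

theorem abs_pot_left (h₁ : IsExit j j (fun i : ℕ => !e (b - 1 - i)) t₁) :
    |pot e b (b - t₁)| = j := by
  rw [pot_sub]; exact h₁.abs_eq

end Exit

/-- The environments seen from `b` and from `q` in both directions, and the steps of the walk. -/
def rows (e e' : ℤ → Bool) (b q : ℤ) (s : ℕ → Bool) : Fin 5 × ℕ → Bool := fun p =>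
  (![fun i : ℕ => e (b + i), fun i : ℕ => !e (b - 1 - i), fun i : ℕ => e' (q + i),
    fun i : ℕ => !e' (q - 1 - i), s] : Fin 5 → ℕ → Bool) p.1 p.2

/-- At a corner the walk reaches a height that no follower can reach in time. -/
theorem not_foll_of_corner {e e' : ℤ → Bool} {b q : ℤ} {s : ℕ → Bool} {j : ℕ} (hj : 1 ≤ j)
    {t : Fin 5 → ℕ} (ht : Lv (rows e e' b q s) j t) (hc : Corner (rows e e' b q s) t) :
    ¬Foll e' e b s q (t 4 + 1) := by
  rintro ⟨τ, hτ⟩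
  have hpot := pot_eq_of_foll hτ
  have e0 : IsExit j j (fun i : ℕ => e (b + i)) (t 0) := ht.1 0 (by decide)
  have e1 : IsExit j j (fun i : ℕ => !e (b - 1 - i)) (t 1) := ht.1 1 (by decide)
  have e2 : IsExit j j (fun i : ℕ => e' (q + i)) (t 2) := ht.1 2 (by decide)
  have e3 : IsExit j j (fun i : ℕ => !e' (q - 1 - i)) (t 3) := ht.1 3 (by decide)
  have e4 : IsExit (t 1) (t 0) s (t 4) := ht.2
  have o0 : outc (fun i : ℕ => e (b + i)) (t 0) = true := hc 0
  have o1 : outc (fun i : ℕ => !e (b - 1 - i)) (t 1) = true := hc 1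
  have o2 : outc (fun i : ℕ => e' (q + i)) (t 2) = false := hc 2
  have o3 : outc (fun i : ℕ => !e' (q - 1 - i)) (t 3) = false := hc 3
  have o4 : outc s (t 4) = true := hc 4
  have n0 := e0.one_le hj
  have n1 := e1.one_le hj
  have n2 := e2.one_le hj
  have n3 := e3.one_le hj
  -- Before time `t 4` the walk is strictly between the two sites where the height first has
  -- absolute value `j`.
  have hwalk : ∀ i < t 4, |pot e b (pos b s i)| < j := by
    intro i hi
    have := e4.1 i hi
    exact abs_pot_lt e0 e1 (by rw [pos_eq_add]; linarith [this.1])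
      (by rw [pos_eq_add]; linarith [this.2])
  have hlast : |pot e b (pos b s (t 4 + 1))| = j + 1 := by
    have hm := e4.mem_Icc (by omega) (by omega)
    have hx := e4.2
    rw [outc, beq_iff_eq] at o4
    rw [pos_eq_add, pos_succ, o4]
    have : pos 0 s (t 4) = t 0 ∨ pos 0 s (t 4) = -(t 1 : ℤ) := by omega
    rcases this with h | h
    · rw [h, decide_eq_true (by omega), st_true]
      have : b + ((t 0 : ℤ) + 1) = b + ((t 0 + 1 : ℕ) : ℤ) := by push_cast; ring
      rw [this, pot_add]
      exact e0.abs_succ_of_outc hj o0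
    · rw [h, decide_eq_false (by omega), st_false]
      have : b + (-(t 1 : ℤ) + -1) = b - ((t 1 + 1 : ℕ) : ℤ) := by push_cast; ring
      rw [this, pot_sub]
      exact e1.abs_succ_of_outc hj o1
  -- To leave its own interval the follower would have to stand on an end point, of absolute height
  -- `j`, before time `t 4`.
  have hfoll : ∀ i ≤ t 4, q - t 3 ≤ pos q τ i ∧ pos q τ i ≤ q + t 2 := by
    intro i
    induction i with
    | zero => intro _; simp
    | succ i ih =>
      intro hi
      have h1 := ih (by omega)
      have h2 := hwalk i (by omega)
      rw [← hpot i (by omega)] at h2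
      have h3 : pos q τ i ≠ q - t 3 := fun h => by
        rw [h, abs_pot_left e3] at h2; exact lt_irrefl _ h2
      have h4 : pos q τ i ≠ q + t 2 := fun h => by
        rw [h, abs_pot_right e2] at h2; exact lt_irrefl _ h2
      rw [pos_succ]
      rcases st_eq_or (τ i) with h | h <;> rw [h] <;> constructor <;> omega
  -- One more step may take the follower just past an end point, but there its height has turned
  -- back.
  have hbound : ∀ z, q - t 3 - 1 ≤ z → z ≤ q + t 2 + 1 → |pot e' q z| ≤ j := by
    intro z h1 h2
    by_cases c1 : z = q + t 2 + 1
    · have : q + (t 2 : ℤ) + 1 = q + ((t 2 + 1 : ℕ) : ℤ) := by push_cast; ring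
      rw [c1, this, pot_add]
      exact e2.abs_succ_le_of_outc hj o2
    by_cases c2 : z = q - t 3 - 1
    · have : q - (t 3 : ℤ) - 1 = q - ((t 3 + 1 : ℕ) : ℤ) := by push_cast; ring
      rw [c2, this, pot_sub]
      exact e3.abs_succ_le_of_outc hj o3
    by_cases c3 : z = q + t 2
    · rw [c3, abs_pot_right e2]
    by_cases c4 : z = q - t 3
    · rw [c4, abs_pot_left e3]
    exact (abs_pot_lt e2 e3 (by omega) (by omega)).le
  rw [← hpot _ le_rfl] at hlast
  have h5 := hfoll (t 4) le_rfl
  have h6 : |pot e' q (pos q τ (t 4 + 1))| ≤ j := by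
    refine hbound _ ?_ ?_ <;> rw [pos_succ] <;>
      rcases st_eq_or (τ (t 4)) with h | h <;> rw [h] <;> omega
  omega

theorem not_foll_of_notMem_badRows {e e' : ℤ → Bool} {b q : ℤ} {s : ℕ → Bool} {J : ℕ}
    (h : rows e e' b q s ∉ BadRows J) : ¬Foll e' e b s q (J ^ 7 + 1) := by
  simp only [BadRows, Set.mem_ofPred_eq, NoCorner, not_forall, not_not] at h
  obtain ⟨⟨t, ht, hn⟩, i, hi, hiJ, t', ht', hc⟩ := h
  have h4 := ht'.lt ht hiJ 4
  have h4' := hn 4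
  exact fun hf => not_foll_of_corner hi ht' hc (hf.mono (by omega))

/-! ### Good sites -/

/-- Coins selected without repetition, as far as they matter. -/
theorem fair_select_depOn {κ κ' : Type} {I : Finset κ'} {B : Set (κ' → Bool)}
    (hB : DepOn (I : Set κ') B) (j : κ' → κ) (hj : Set.InjOn j I) (g : κ' → Bool) :
    fair κ {ω | (fun i => xor (ω (j i)) (g i)) ∈ B} = fair κ' B := by
  have hm : ∀ {κ : Type} (j : I → κ) (g : I → Bool),
      Measurable fun (ω : κ → Bool) (i : I) => xor (ω (j i)) (g i) := fun j g =>
    measurable_pi_lambda _ fun i =>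
      (measurable_of_finite fun b : Bool => xor b (g i)).comp (measurable_pi_apply (j i))
  have h1 := fair_map_select (κ := κ) (fun i : I => j i)
    (fun a b h => Subtype.ext (hj a.2 b.2 h)) (fun i => g i)
  have h2 := fair_map_select (κ := κ') (fun i : I => (i : κ')) Subtype.val_injective
    (fun _ => false)
  have hR : MeasurableSet (I.restrict '' B : Set (I → Bool)) := (Set.toFinite _).measurableSet
  have h3 := congrArg (fun μ => μ (I.restrict '' B : Set (I → Bool))) (h1.trans h2.symm)
  simp only [Measure.map_apply (hm _ _) hR] at h3
  convert h3 using 2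
  · ext ω
    nth_rewrite 1 [← hB.preimage_restrict]
    rfl
  · ext ω
    nth_rewrite 1 [← hB.preimage_restrict]
    simp only [Set.mem_preimage, Bool.xor_false]
    rfl

/-- The environment with the two edges at `x` turned. -/
def tw (x : ℤ) (e : ℤ → Bool) : ℤ → Bool := fun z => xor (e z) (decide (z = x - 1 ∨ z = x))

theorem measurable_rows (x b q : ℤ) :
    Measurable fun p : (ℤ → Bool) × (ℕ → Bool) => rows p.1 (tw x p.1) b q p.2 := by
  have h1 : ∀ z, Measurable fun p : (ℤ → Bool) × (ℕ → Bool) => p.1 z := fun z =>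
    (measurable_pi_apply z).comp measurable_fst
  have h2 : ∀ z, Measurable fun p : (ℤ → Bool) × (ℕ → Bool) => tw x p.1 z := fun z =>
    (measurable_of_finite fun c : Bool => xor c (decide (z = x - 1 ∨ z = x))).comp (h1 z)
  refine measurable_pi_lambda _ fun ⟨k, i⟩ => ?_
  fin_cases k
  · exact h1 _
  · exact (measurable_of_finite not).comp (h1 _)
  · exact h2 _
  · exact (measurable_of_finite not).comp (h2 _)
  · exact (measurable_pi_apply i).comp measurable_snd

/-- The windows of radius `J ^ 7 + 1` around `b` and `q` share no edge, so the relevant coins of the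
five rows are distinct. The turned edges at `x` and the reversed orientation only negate some coins,
which `g` records. -/
theorem prod_rows_badRows (x b q : ℤ) (J : ℕ) (hq : 2 * ((J : ℤ) ^ 7 + 1) ≤ |q - b|) :
    ((fair ℤ).prod (fair ℕ)) {p | rows p.1 (tw x p.1) b q p.2 ∈ BadRows J}
      = fair (Fin 5 × ℕ) (BadRows J) := by
  set f : Fin 5 × ℕ → ℤ ⊕ ℕ := fun p =>
    (![fun i : ℕ => Sum.inl (b + i), fun i : ℕ => Sum.inl (b - 1 - i),
      fun i : ℕ => Sum.inl (q + i), fun i : ℕ => Sum.inl (q - 1 - i), fun i : ℕ => Sum.inr i] :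
        Fin 5 → ℕ → ℤ ⊕ ℕ) p.1 p.2 with hf
  set g : Fin 5 × ℕ → Bool := fun p =>
    (![fun _ : ℕ => false, fun _ : ℕ => true,
      fun i : ℕ => decide (q + i = x - 1 ∨ q + i = x),
      fun i : ℕ => !decide (q - 1 - i = x - 1 ∨ q - 1 - i = x), fun _ : ℕ => false] :
        Fin 5 → ℕ → Bool) p.1 p.2 with hg
  have hinj : Set.InjOn f ((Finset.univ ×ˢ Finset.range (J ^ 7 + 1) : Finset (Fin 5 × ℕ)) :
      Set (Fin 5 × ℕ)) := by
    rintro ⟨k, i⟩ hi ⟨k', i'⟩ hi' h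
    simp only [Finset.coe_product, Finset.coe_univ, Finset.coe_range, Set.mem_prod, Set.mem_univ,
      Set.mem_Iio, true_and] at hi hi'
    have hi2 : (i : ℤ) < (J : ℤ) ^ 7 + 1 := by exact_mod_cast hi
    have hi3 : (i' : ℤ) < (J : ℤ) ^ 7 + 1 := by exact_mod_cast hi'
    rw [le_abs] at hq
    fin_cases k <;> fin_cases k' <;> simp [hf] at h ⊢ <;> omega
  rw [← fair_select_depOn (depOn_badRows J) f hinj g, ← fair_prod_map,
    Measure.map_apply]
  · congr 1
    ext p
    simp only [Set.mem_ofPred_eq, Set.mem_preimage]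
    congr! 1
    funext ⟨k, i⟩
    fin_cases k <;> simp only [rows, hf, hg, tw] <;> simp
    rw [← Bool.not_or, Bool.xor_not, Bool.not_not]
  · refine measurable_pi_lambda _ fun i => ?_
    cases i with
    | inl a => exact (measurable_pi_apply a).comp measurable_fst
    | inr b => exact (measurable_pi_apply b).comp measurable_snd
  · refine MeasurableSet.preimage (depOn_badRows J).measurableSet ?_
    exact measurable_pi_lambda _ fun i =>
      (measurable_of_finite fun b : Bool => xor b (g i)).comp (measurable_pi_apply (f i))

/-- The distance that belongs to level `J`. -/
def dist7 (J : ℕ) : ℕ := 2 * (J ^ 7 + 1)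

/-- With positive probability, no follower from a distant site survives. -/
def Good (x : ℤ) (J : ℕ) (b : ℤ) (e : ℤ → Bool) : Prop :=
  fair ℕ {s | ∃ q, (dist7 J : ℤ) ≤ |q - b| ∧ ∀ n, Foll (tw x e) e b s q n} < 1

/-- The sites at a distance between two consecutive levels. -/
noncomputable def band (b : ℤ) (J : ℕ) : Finset ℤ :=
  (Finset.Icc (b - dist7 (J + 1)) (b + dist7 (J + 1))).filter fun q => (dist7 J : ℤ) ≤ |q - b|

theorem dist7_lt (J : ℕ) : J < dist7 J := by
  have : J ≤ J ^ 7 := Nat.le_self_pow (by omega) J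
  unfold dist7; omega

theorem exists_mem_band {b q : ℤ} {J₀ : ℕ} (h : (dist7 J₀ : ℤ) ≤ |q - b|) :
    ∃ J, q ∈ band b (J₀ + J) := by
  classical
  have hex : ∃ J, |q - b| < dist7 (J₀ + J + 1) := by
    refine ⟨(|q - b|).toNat, ?_⟩
    have := dist7_lt (J₀ + (|q - b|).toNat + 1)
    have := abs_nonneg (q - b)
    omega
  have h1 := Nat.find_spec hex
  refine ⟨Nat.find hex, ?_⟩
  have h2 : (dist7 (J₀ + Nat.find hex) : ℤ) ≤ |q - b| := by
    rcases Nat.eq_zero_or_pos (Nat.find hex) with h0 | h0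
    · rw [h0]; exact h
    · have := Nat.find_min hex (m := Nat.find hex - 1) (by omega)
      rw [not_lt] at this
      rwa [show J₀ + (Nat.find hex - 1) + 1 = J₀ + Nat.find hex by omega] at this
  rw [abs_lt] at h1
  simp only [band, Finset.mem_filter, Finset.mem_Icc]
  exact ⟨⟨by linarith [h1.1], by linarith [h1.2]⟩, h2⟩

theorem card_band_le (b : ℤ) (J : ℕ) : (band b J).card ≤ 9 * (J + 1) ^ 7 := by
  refine (Finset.card_filter_le _ _).trans ?_
  have : 1 ≤ (J + 1) ^ 7 := Nat.one_le_pow _ _ (by omega)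
  rw [Int.card_Icc]
  unfold dist7
  omega

/-- Expected number of bad pairs. -/
noncomputable def badSum (x : ℤ) (J₀ : ℕ) (b : ℤ) (e : ℤ → Bool) : ℝ≥0∞ :=
  ∑' J, ∑ q ∈ band b (J₀ + J), fair ℕ {s | rows e (tw x e) b q s ∈ BadRows (J₀ + J)}

theorem good_of_badSum_lt {x : ℤ} {J₀ : ℕ} {b : ℤ} {e : ℤ → Bool} (h : badSum x J₀ b e < 1) :
    Good x J₀ b e := by
  refine lt_of_le_of_lt ?_ h
  have hsub : {s | ∃ q, (dist7 J₀ : ℤ) ≤ |q - b| ∧ ∀ n, Foll (tw x e) e b s q n}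
      ⊆ ⋃ J, ⋃ q ∈ band b (J₀ + J), {s | rows e (tw x e) b q s ∈ BadRows (J₀ + J)} := by
    rintro s ⟨q, hq, hn⟩
    obtain ⟨J, hJ⟩ := exists_mem_band hq
    refine Set.mem_iUnion.2 ⟨J, Set.mem_iUnion₂.2 ⟨q, hJ, ?_⟩⟩
    by_contra hc
    exact not_foll_of_notMem_badRows hc (hn _)
  exact (measure_mono hsub).trans ((measure_iUnion_le _).trans
    (ENNReal.tsum_le_tsum fun J => measure_biUnion_finset_le _ _))

/-- First moment bound: Markov's inequality for `badSum`, whose terms are evaluated by Fubini. The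
constant is `9 * 16`, from the size of a band and from `fair_badRows_le`. -/
theorem not_good_le (x : ℤ) (J₀ : ℕ) (hJ₀ : 2 ≤ J₀) (b : ℤ) :
    fair ℤ {e | ¬Good x J₀ b e}
      ≤ ∑' J, ENNReal.ofReal (144 * ((J₀ + J : ℕ) + 1) ^ 7 * (31 / 32) ^ (J₀ + J)) := by
  have hms : ∀ q J, MeasurableSet
      {p : (ℤ → Bool) × (ℕ → Bool) | rows p.1 (tw x p.1) b q p.2 ∈ BadRows J} := fun q J =>
    (measurable_rows x b q) (depOn_badRows J).measurableSet
  have hmeas : ∀ q J, Measurable fun e => fair ℕ {s | rows e (tw x e) b q s ∈ BadRows J} :=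
    fun q J => measurable_measure_prodMk_left (hms q J)
  have hm : Measurable (badSum x J₀ b) :=
    Measurable.tsum fun J => Finset.measurable_sum _ fun q _ => hmeas q _
  have h1 : fair ℤ {e | ¬Good x J₀ b e} ≤ ∫⁻ e, badSum x J₀ b e ∂fair ℤ := by
    have := mul_meas_ge_le_lintegral₀ (μ := fair ℤ) hm.aemeasurable 1
    rw [one_mul] at this
    refine (measure_mono fun e he => ?_).trans this
    by_contra hc
    exact he (good_of_badSum_lt (not_le.1 hc))
  refine h1.trans ?_
  unfold badSum
  rw [lintegral_tsum fun J => (Finset.measurable_sum _ fun q _ => hmeas q _).aemeasurable]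
  refine ENNReal.tsum_le_tsum fun J => ?_
  rw [lintegral_finsetSum _ fun q _ => hmeas q _]
  have h2 : ∀ q ∈ band b (J₀ + J),
      ∫⁻ e, fair ℕ {s | rows e (tw x e) b q s ∈ BadRows (J₀ + J)} ∂fair ℤ
        ≤ ENNReal.ofReal (16 * (31 / 32) ^ (J₀ + J)) := by
    intro q hq
    have h3 := Measure.prod_apply (μ := fair ℤ) (ν := fair ℕ) (hms q (J₀ + J))
    have h4 : 2 * (((J₀ + J : ℕ) : ℤ) ^ 7 + 1) ≤ |q - b| := by
      have := (Finset.mem_filter.1 hq).2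
      unfold dist7 at this
      push_cast at this ⊢
      exact this
    rw [prod_rows_badRows x b q _ h4] at h3
    refine h3.symm.le.trans ?_
    rw [← ENNReal.ofReal_toReal (a := fair (Fin 5 × ℕ) (BadRows (J₀ + J))) (by finiteness)]
    exact ENNReal.ofReal_le_ofReal (fair_badRows_le _ (by omega))
  refine (Finset.sum_le_sum h2).trans ?_
  rw [Finset.sum_const, nsmul_eq_mul, ← ENNReal.ofReal_natCast,
    ← ENNReal.ofReal_mul (by positivity)]
  refine ENNReal.ofReal_le_ofReal ?_
  have h5 : ((band b (J₀ + J)).card : ℝ) ≤ 9 * ((J₀ + J : ℕ) + 1) ^ 7 := by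
    exact_mod_cast card_band_le b (J₀ + J)
  have h6 : (0 : ℝ) < 16 * (31 / 32) ^ (J₀ + J) := by positivity
  calc _ ≤ 9 * (((J₀ + J : ℕ) : ℝ) + 1) ^ 7 * (16 * (31 / 32) ^ (J₀ + J)) := by gcongr
    _ = _ := by ring

/-- Polynomially many sites are good simultaneously. -/
theorem exists_not_good_bound : ∃ ε : ℕ → ℝ≥0∞, Filter.Tendsto ε Filter.atTop (nhds 0) ∧
    ∀ (x : ℤ) (J : ℕ) (b : ℤ), 2 ≤ J →
      (J : ℝ≥0∞) ^ 14 * fair ℤ {e | ¬Good x J b e} ≤ ε J := by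
  -- The exponent is `7 + 14`: the size of a band and the factor `J ^ 14` of the claim, moved inside
  -- the sum. Then `ε` is the tail of a convergent series.
  set f : ℕ → ℝ := fun J => 144 * ((J : ℝ) + 1) ^ 21 * (31 / 32) ^ J with hf
  have hsum : Summable f := by
    have h := summable_pow_mul_geometric_of_norm_lt_one 21 (r := (31 / 32 : ℝ)) (by norm_num)
    have h' := ((summable_nat_add_iff 1).2 h).mul_left (144 * (32 / 31))
    refine h'.congr fun J => ?_
    simp only [hf]
    push_cast
    rw [pow_succ (31 / 32 : ℝ) J]
    ring
  have hne : ∑' J, ENNReal.ofReal (f J) ≠ ⊤ := hsum.tsum_ofReal_ne_top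
  refine ⟨fun J₀ => ∑' J, ENNReal.ofReal (f (J + J₀)), ENNReal.tendsto_sum_nat_add _ hne,
    fun x J₀ b hJ₀ => ?_⟩
  refine (mul_le_mul_right (not_good_le x J₀ hJ₀ b) _).trans ?_
  rw [← ENNReal.tsum_mul_left]
  refine ENNReal.tsum_le_tsum fun J => ?_
  rw [← ENNReal.ofReal_natCast, ← ENNReal.ofReal_pow (by positivity),
    ← ENNReal.ofReal_mul (by positivity)]
  refine ENNReal.ofReal_le_ofReal ?_
  simp only [hf]
  rw [add_comm J J₀]
  have h1 : (J₀ : ℝ) ^ 14 ≤ ((J₀ + J : ℕ) + 1) ^ 14 := by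
    refine pow_le_pow_left₀ (by positivity) ?_ 14
    push_cast
    linarith [(Nat.cast_nonneg J : (0 : ℝ) ≤ J)]
  calc _ ≤ (((J₀ + J : ℕ) : ℝ) + 1) ^ 14
        * (144 * (((J₀ + J : ℕ) : ℝ) + 1) ^ 7 * (31 / 32) ^ (J₀ + J)) := by gcongr
    _ = _ := by ring

/-! ### Beacons and the escape from all followers -/

theorem inc_reverse (e : ℤ → Bool) (z : ℤ) (b : Bool) : inc e (z + st b) (!b) = !inc e z b := by
  cases b <;> simp [inc, sub_eq_add_neg]

/-- The steps of the reversed path. -/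
def rev (s : ℕ → Bool) (n : ℕ) : ℕ → Bool := fun i => !s (n - 1 - i)

theorem pos_rev (q : ℤ) (τ : ℕ → Bool) (n i : ℕ) (hi : i ≤ n) :
    pos (pos q τ n) (rev τ n) i = pos q τ (n - i) := by
  induction i with
  | zero => simp
  | succ i ih =>
    have h : n - i = n - 1 - i + 1 := by omega
    rw [pos_succ, ih (by omega), h, pos_succ, rev, show n - (i + 1) = n - 1 - i by omega]
    cases τ (n - 1 - i) <;> simp

theorem inc_rev (e : ℤ → Bool) (q : ℤ) (τ : ℕ → Bool) (n i : ℕ) (hi : i < n) :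
    inc e (pos (pos q τ n) (rev τ n) i) (rev τ n i)
      = !inc e (pos q τ (n - 1 - i)) (τ (n - 1 - i)) := by
  rw [pos_rev q τ n i hi.le, show n - i = n - 1 - i + 1 by omega, pos_succ, rev, inc_reverse]

/-- Traversing both paths backwards reverses the order of the symbols and negates each, so agreement
persists. Thus control over where followers start becomes control over where they end. -/
theorem foll_rev {e' e : ℤ → Bool} {z q : ℤ} {s τ : ℕ → Bool} {n : ℕ}
    (h : ∀ i < n, inc e' (pos q τ i) (τ i) = inc e (pos z s i) (s i)) :
    Foll e' e (pos z s n) (rev s n) (pos q τ n) n :=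
  ⟨rev τ n, fun i hi => by rw [inc_rev _ _ _ _ _ hi, inc_rev _ _ _ _ _ hi, h _ (by omega)]⟩

/-- The site `y` is recognized, among those at distance less than `D`, by the run of `H` ones
that starts there. -/
def Beacon (e : ℤ → Bool) (y : ℤ) (D H : ℕ) : Prop :=
  (∀ i < H, e (y + i) = true) ∧
  (∀ p, p ≠ y → |p - y| < D → ∃ i < H, e (p + i) = false) ∧
  ∀ p, |p - y| < D → ∃ i < H, e (p - 1 - i) = true

theorem beacon_tw {e : ℤ → Bool} {x y : ℤ} {D H : ℕ} (h : Beacon e y D H)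
    (hx : y + D + H < x - 1 ∨ x < y - D - H) : Beacon (tw x e) y D H := by
  have htw : ∀ z, y - D - H ≤ z → z ≤ y + D + H → tw x e z = e z := by
    intro z h1 h2
    simp only [tw]
    rw [decide_eq_false (by omega), Bool.xor_false]
  obtain ⟨h1, h2, h3⟩ := h
  refine ⟨fun i hi => ?_, fun p hp hpy => ?_, fun p hpy => ?_⟩
  · rw [htw _ (by omega) (by omega)]; exact h1 i hi
  · obtain ⟨i, hi, h⟩ := h2 p hp hpy
    rw [abs_lt] at hpy
    exact ⟨i, hi, by rw [htw _ (by omega) (by omega)]; exact h⟩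
  · obtain ⟨i, hi, h⟩ := h3 p hpy
    rw [abs_lt] at hpy
    exact ⟨i, hi, by rw [htw _ (by omega) (by omega)]; exact h⟩

theorem pos_true (z : ℤ) {s : ℕ → Bool} {n : ℕ} (h : ∀ i < n, s i = true) : pos z s n = z + n := by
  induction n with
  | zero => simp
  | succ n ih =>
    rw [pos_succ, ih fun i hi => h i (by omega), h n (by omega), st_true]; push_cast; ring

theorem pos_false (z : ℤ) {s : ℕ → Bool} {n : ℕ} (h : ∀ i < n, s i = false) :
    pos z s n = z - n := by
  induction n with
  | zero => simp
  | succ n ih =>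
    rw [pos_succ, ih fun i hi => h i (by omega), h n (by omega), st_false]; push_cast; ring

/-- A path that sees only ones never turns. -/
theorem straight_of_inc_true {e : ℤ → Bool} {p : ℤ} {τ : ℕ → Bool} {H : ℕ}
    (h : ∀ i < H, inc e (pos p τ i) (τ i) = true) : ∀ i < H, τ i = τ 0 := by
  intro i
  induction i with
  | zero => intro _; rfl
  | succ i ih =>
    intro hi
    rw [← ih (by omega)]
    by_contra hne
    have h1 : τ (i + 1) = !τ i := Bool.eq_not.2 hne
    have h2 := h (i + 1) hi
    rw [pos_succ, h1, inc_reverse, h i (by omega)] at h2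
    simp at h2

/-- Near a beacon, only a path from the beacon itself can see the run of ones. -/
theorem Beacon.eq_of_inc_true {e : ℤ → Bool} {y : ℤ} {D H : ℕ} (hB : Beacon e y D H) {p : ℤ}
    (hp : |p - y| < D) {τ : ℕ → Bool} (h : ∀ i < H, inc e (pos p τ i) (τ i) = true) : p = y := by
  have hs := straight_of_inc_true h
  cases h0 : τ 0 with
  | true =>
    by_contra hne
    obtain ⟨i, hi, hf⟩ := hB.2.1 p hne hp
    have h1 := h i hi
    rw [pos_true p fun k hk => (hs k (by omega)).trans h0, hs i hi, h0] at h1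
    simp [inc, hf] at h1
  | false =>
    exfalso
    obtain ⟨i, hi, hf⟩ := hB.2.2 p hp
    have h1 := h i hi
    rw [pos_false p fun k hk => (hs k (by omega)).trans h0, hs i hi, h0] at h1
    rw [show p - 1 - (i : ℤ) = p - i - 1 by ring] at hf
    simp [inc, hf] at h1

/-- No follower stays close to a walk that goes straight from one beacon to another and
crosses `x` on the way. -/
theorem far_of_straight {e : ℤ → Bool} {x yl yr : ℤ} {D H n : ℕ} (hl : Beacon e yl D H)
    (hr : Beacon e yr D H) (hl' : Beacon (tw x e) yl D H) (hr' : Beacon (tw x e) yr D H)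
    (hlx : yl ≤ x) (hxr : x < yr) (hn : (n : ℤ) = yr + H - yl) {p : ℤ} {σ : ℕ → Bool}
    (hσ : ∀ i < n, inc (tw x e) (pos p σ i) (σ i) = e (yl + i))
    (hp : |p - yl| < D ∨ (2 * n + D : ℤ) < |p - yl|) : (D : ℤ) ≤ |pos p σ n - (yl + n)| := by
  by_contra! hlt
  -- Relative to a walk that only moves up, a follower never gains and loses at most `2` per step.
  have hmono : ∀ k i, pos p σ (i + k) - (i + k : ℕ) ≤ pos p σ i - i ∧
      pos p σ i - i - 2 * k ≤ pos p σ (i + k) - (i + k : ℕ) := by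
    intro k i
    induction k with
    | zero => simp
    | succ k ih =>
      rw [← add_assoc, pos_succ]
      push_cast at ih ⊢
      rcases st_eq_or (σ (i + k)) with h | h <;> rw [h] <;> constructor <;> omega
  have hp' : |p - yl| < D := by
    refine hp.resolve_right fun hc => ?_
    have := hmono n 0
    simp only [zero_add, pos_zero, Nat.cast_zero, sub_zero] at this
    rw [abs_lt] at hlt
    rw [lt_abs] at hc
    omega
  have hpy : p = yl := hl'.eq_of_inc_true hp' fun i hi => by
    rw [hσ i (by omega)]; exact hl.1 i hi
  subst hpy
  obtain ⟨m, hm⟩ : ∃ m : ℕ, (m : ℤ) = yr - p := ⟨(yr - p).toNat, by omega⟩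
  have hmn : n = m + H := by omega
  -- The relative position is monotone and stays within `D` up to time `n`, so the follower is near
  -- `yr` when the walk reads the second beacon.
  have hgap : pos p σ m = yr := by
    refine hr'.eq_of_inc_true (τ := shift m σ) ?_ fun i hi => ?_
    · have h1 := hmono m 0
      have h2 := hmono H m
      rw [← hmn] at h2
      simp only [zero_add, pos_zero, Nat.cast_zero, sub_zero] at h1
      rw [abs_lt] at hlt ⊢
      omega
    · rw [← pos_add]
      have h1 := hσ (m + i) (by omega)
      rw [show p + ((m + i : ℕ) : ℤ) = yr + i by push_cast; omega, hr.1 i hi] at h1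
      exact h1
  -- The relative position vanishes at times `0` and `m`, hence throughout; the follower then
  -- crosses the turned edge at `x` upwards.
  have hall : ∀ k ≤ m, pos p σ k = p + k := by
    intro k hk
    have h1 := hmono k 0
    have h2 := hmono (m - k) k
    rw [show k + (m - k) = m by omega] at h2
    simp only [zero_add, pos_zero, Nat.cast_zero, sub_zero] at h1
    omega
  obtain ⟨k, hk⟩ : ∃ k : ℕ, (k : ℤ) = x - p := ⟨(x - p).toNat, by omega⟩
  have h1 := hall k (by omega)
  have h2 := hall (k + 1) (by omega)
  have h3 : σ k = true := by
    rw [pos_succ, h1] at h2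
    cases hc : σ k with
    | true => rfl
    | false => rw [hc, st_false] at h2; push_cast at h2; omega
  have h4 := hσ k (by omega)
  rw [h1, h3, show p + (k : ℤ) = x by omega] at h4
  simp [inc, tw] at h4

/-- Two beacons at good sites on both sides of `x` allow the walk to escape from all followers. -/
theorem exists_escape {e : ℤ → Bool} {x yl yr : ℤ} {J H : ℕ} (hl : Beacon e yl (dist7 J) H)
    (hr : Beacon e yr (dist7 J) H) (hlx : yl + dist7 J + H < x - 1) (hxr : x < yr - dist7 J - H)
    (gl : Good x J yl e) (gr : Good x J (yr + H) e) :
    ∃ z₀, fair ℕ {s | ∃ q, ∀ n, Foll (tw x e) e z₀ s q n} < 1 := by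
  have hl' := beacon_tw hl (Or.inl hlx)
  have hr' := beacon_tw hr (Or.inr hxr)
  obtain ⟨n₁, hn₁⟩ : ∃ n : ℕ, (n : ℤ) = yr + H - yl := ⟨(yr + H - yl).toNat, by omega⟩
  -- Followers farther than `R` from the left beacon remain distant during the `n₁` straight steps,
  -- so only finitely many sites have to be excluded, and one time `n₀` serves for them all.
  set R : ℤ := 2 * n₁ + dist7 J with hR
  obtain ⟨s₀, hs₀⟩ : ∃ s₀, s₀ ∉ {s | ∃ q, (dist7 J : ℤ) ≤ |q - yl| ∧
      ∀ n, Foll (tw x e) e yl s q n} := by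
    by_contra! hc
    have : {s | ∃ q, (dist7 J : ℤ) ≤ |q - yl| ∧ ∀ n, Foll (tw x e) e yl s q n} = Set.univ :=
      Set.eq_univ_of_forall hc
    rw [Good, this, measure_univ] at gl
    exact lt_irrefl _ gl
  obtain ⟨n₀, hn₀⟩ : ∃ n₀, ∀ q, (dist7 J : ℤ) ≤ |q - yl| → |q - yl| ≤ R →
      ¬Foll (tw x e) e yl s₀ q n₀ := by
    by_contra! hc
    obtain ⟨q, hq, hf⟩ := exists_forall_of_antitone (F := Finset.Icc (yl - R) (yl + R))
      (p := fun q n => (dist7 J : ℤ) ≤ |q - yl| ∧ Foll (tw x e) e yl s₀ q n)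
      (fun _ _ _ hnm h => ⟨h.1, h.2.mono hnm⟩) fun n => by
        obtain ⟨q, h1, h2, h3⟩ := hc n
        rw [abs_le] at h2
        exact ⟨q, by rw [Finset.mem_Icc]; constructor <;> linarith [h2.1, h2.2], h1, h3⟩
    exact hs₀ ⟨q, (hf 0).1, fun n => (hf n).2⟩
  set z₀ := pos yl s₀ n₀ with hz₀
  set N := n₀ + n₁ with hN
  -- From `z₀`, retrace `s₀` back to `yl`, then go straight to `yr + H`. A follower ending the first
  -- stage at `q` would, reversed, follow `s₀` from `q`, which the choice of `n₀` forbids for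
  -- intermediate distances.
  set W : ℕ → Bool := fun i => if i < n₀ then rev s₀ n₀ i else true with hW
  have hfar : ∀ s : ℕ → Bool, (∀ i < N, s i = W i) → ∀ q τ,
      (∀ i < N, inc (tw x e) (pos q τ i) (τ i) = inc e (pos z₀ s i) (s i)) →
      (dist7 J : ℤ) ≤ |pos q τ N - (yr + H)| ∧ pos z₀ s N = yr + H := by
    intro s hs q τ hτ
    have hs1 : ∀ i < n₀, s i = rev s₀ n₀ i := fun i hi => by
      rw [hs i (by omega), hW]; simp [hi]
    have hs2 : ∀ i < n₁, shift n₀ s i = true := fun i hi => by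
      rw [shift, hs _ (by omega), hW]; simp
    have hback : pos z₀ s n₀ = yl := by
      rw [pos_congr z₀ hs1, hz₀, pos_rev _ _ _ _ le_rfl]; simp
    have hpos : ∀ i ≤ n₁, pos z₀ s (n₀ + i) = yl + i := fun i hi => by
      rw [pos_add, hback]
      exact pos_true yl fun k hk => hs2 k (by omega)
    have hrev := foll_rev (n := n₀) fun i hi => hτ i (by omega)
    rw [hback] at hrev
    have hrev' : Foll (tw x e) e yl s₀ (pos q τ n₀) n₀ := hrev.congr fun i hi => by
      rw [rev, hs1 _ (by omega), rev, Bool.not_not]; congr 1; omega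
    have hp : |pos q τ n₀ - yl| < dist7 J ∨ (2 * n₁ + dist7 J : ℤ) < |pos q τ n₀ - yl| := by
      by_contra! hc
      exact hn₀ _ hc.1 hc.2 hrev'
    have := far_of_straight hl hr hl' hr' (by omega) (by omega) hn₁ (σ := shift n₀ τ)
      (fun i hi => by
        have h1 := hτ (n₀ + i) (by omega)
        rw [hpos i hi.le] at h1
        rw [← pos_add]
        refine h1.trans ?_
        have h2 : s (n₀ + i) = true := hs2 i hi
        rw [h2]; rfl) hp
    rw [← pos_add] at this
    have hb : yl + (n₁ : ℤ) = yr + H := by omega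
    rw [hb] at this
    exact ⟨this, by rw [hN, hpos n₁ le_rfl, hb]⟩
  set Kb := {s | ∃ q, (dist7 J : ℤ) ≤ |q - (yr + H)| ∧ ∀ n, Foll (tw x e) e (yr + H) s q n}
    with hKb
  set P : Set (ℕ → Bool) := {s | ∀ i ∈ Finset.range N, s i = W i} with hP
  have hPdep : DepOn (Finset.range N : Set ℕ) P := fun s s' h hs i hi => by
    rw [← h i hi]; exact hs i hi
  have hPpos : fair ℕ P ≠ 0 := by
    rw [hP, fair_cylinder]; simp
  -- After the prescribed steps only distant followers remain, and goodness of `yr + H` gives a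
  -- positive chance to lose them.
  have hsub : {s | ∃ q, ∀ n, Foll (tw x e) e z₀ s q n} ⊆ Pᶜ ∪ (P ∩ shift N ⁻¹' Kb) := by
    rintro s ⟨q, hq⟩
    by_cases hs : s ∈ P
    · refine Or.inr ⟨hs, ?_⟩
      have hs' : ∀ i < N, s i = W i := fun i hi => hs i (Finset.mem_range.2 hi)
      obtain ⟨q', -, hf⟩ := exists_forall_of_antitone (F := Finset.Icc (q - N) (q + N))
        (p := fun q' n => (dist7 J : ℤ) ≤ |q' - (yr + H)| ∧
          Foll (tw x e) e (yr + H) (shift N s) q' n)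
        (fun _ _ _ hnm h => ⟨h.1, h.2.mono hnm⟩) fun n => by
          obtain ⟨τ, hτ⟩ := hq (N + n)
          obtain ⟨h1, h2⟩ := hfar s hs' q τ fun i hi => hτ i (by omega)
          have h3 := abs_pos_sub_le q τ N
          rw [abs_le] at h3
          refine ⟨pos q τ N, by rw [Finset.mem_Icc]; constructor <;> linarith [h3.1, h3.2], h1,
            shift N τ, fun i hi => ?_⟩
          rw [← h2, ← pos_add, ← pos_add]
          exact hτ (N + i) (by omega)
      exact ⟨q', (hf 0).1, fun n => (hf n).2⟩
    · exact Or.inl hs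
  refine ⟨z₀, ?_⟩
  calc _ ≤ fair ℕ Pᶜ + fair ℕ (P ∩ shift N ⁻¹' Kb) := (measure_mono hsub).trans (measure_union_le _ _)
    _ ≤ fair ℕ Pᶜ + fair ℕ P * fair ℕ Kb := by
        rw [fair_past_future hPdep]
        exact add_le_add le_rfl (mul_le_mul_right (fair_preimage_shift_le _ _) _)
    _ < fair ℕ Pᶜ + fair ℕ P * 1 := by
        refine ENNReal.add_lt_add_left (by finiteness) ?_
        exact ENNReal.mul_lt_mul_right hPpos (by finiteness) gr
    _ = 1 := by
        rw [mul_one, add_comm]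
        exact prob_add_prob_compl hPdep.measurableSet

/-! ### Existence of beacons -/

theorem Beacon.congr {e e' : ℤ → Bool} {y : ℤ} {D H : ℕ}
    (h : ∀ z ∈ Finset.Icc (y - D - H) (y + D + H), e z = e' z) (hB : Beacon e y D H) :
    Beacon e' y D H := by
  simp only [Finset.mem_Icc] at h
  obtain ⟨h1, h2, h3⟩ := hB
  refine ⟨fun i hi => ?_, fun p hp hpy => ?_, fun p hpy => ?_⟩
  · rw [← h _ (by omega)]; exact h1 i hi
  · obtain ⟨i, hi, hf⟩ := h2 p hp hpy
    rw [abs_lt] at hpy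
    exact ⟨i, hi, by rw [← h _ (by omega)]; exact hf⟩
  · obtain ⟨i, hi, hf⟩ := h3 p hpy
    rw [abs_lt] at hpy
    exact ⟨i, hi, by rw [← h _ (by omega)]; exact hf⟩

theorem depOn_not_beacon (y : ℤ) (D H : ℕ) :
    DepOn (Finset.Icc (y - D - H) (y + D + H) : Set ℤ) {e | ¬Beacon e y D H} :=
  fun _ _ h hb hb' => hb (hb'.congr fun z hz => (h z (by exact_mod_cast hz)).symm)

theorem fairReal_cylinder {κ : Type} [DecidableEq κ] (I : Finset κ) (v : κ → Bool) :
    (fair κ).real {ω | ∀ i ∈ I, ω i = v i} = (1 / 2) ^ I.card := by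
  rw [measureReal_def, fair_cylinder]; simp

/-- The zeros that frame the run at `y` exclude every other run that meets the frame. A run disjoint
from it prescribes `H` further coins. -/
theorem fairReal_run_true_le {y p : ℤ} {H : ℕ} (hp : p ≠ y) :
    (fair ℤ).real {e | (∀ z ∈ Finset.Icc (y - 1) (y + H), e z = decide (y ≤ z ∧ z < y + H)) ∧
      ∀ i < H, e (p + i) = true} ≤ (1 / 2) ^ (2 * H + 2) := by
  by_cases hd : p + H < y ∨ y + H < p
  · have hcard : (Finset.Icc (y - 1) (y + H) ∪ Finset.Ico p (p + H)).card = 2 * H + 2 := by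
      rw [Finset.card_union_of_disjoint]
      · simp; omega
      · rw [Finset.disjoint_left]
        intro z h1 h2
        rw [Finset.mem_Icc] at h1
        rw [Finset.mem_Ico] at h2
        omega
    rw [← hcard, ← fairReal_cylinder _
      fun z => decide ((y ≤ z ∧ z < y + H) ∨ (p ≤ z ∧ z < p + H))]
    refine measureReal_mono ?_
    rintro e ⟨h1, h2⟩ z hz
    rw [Finset.mem_union, Finset.mem_Icc, Finset.mem_Ico] at hz
    rcases hz with hz | hz
    · rw [h1 z (Finset.mem_Icc.2 hz)]
      congr 1
      simp only [eq_iff_iff]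
      omega
    · have := h2 (z - p).toNat (by omega)
      rw [show p + ((z - p).toNat : ℤ) = z by omega] at this
      rw [this, eq_comm, decide_eq_true_iff]
      exact Or.inr hz
  · have hempty : {e : ℤ → Bool |
        (∀ z ∈ Finset.Icc (y - 1) (y + H), e z = decide (y ≤ z ∧ z < y + H)) ∧
          ∀ i < H, e (p + i) = true} ⊆ ∅ := by
      rintro e ⟨h1, h2⟩
      rcases lt_or_gt_of_ne hp with hlt | hlt
      · have h3 := h1 (y - 1) (Finset.mem_Icc.2 (by omega))
        have h4 := h2 (y - 1 - p).toNat (by omega)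
        rw [show p + ((y - 1 - p).toNat : ℤ) = y - 1 by omega, h3, decide_eq_true_iff] at h4
        omega
      · have h3 := h1 (y + H) (Finset.mem_Icc.2 (by omega))
        have h4 := h2 (y + H - p).toNat (by omega)
        rw [show p + ((y + H - p).toNat : ℤ) = y + H by omega, h3, decide_eq_true_iff] at h4
        omega
    rw [Set.subset_empty_iff.1 hempty]
    simp

/-- A run of zeros cannot meet the run of ones, but may contain a framing zero; hence only the two
runs are counted, without the frame. -/
theorem fairReal_run_false_le {y p : ℤ} {H : ℕ} (hH : 1 ≤ H) :
    (fair ℤ).real {e | (∀ z ∈ Finset.Icc (y - 1) (y + H), e z = decide (y ≤ z ∧ z < y + H)) ∧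
      ∀ i < H, e (p - 1 - i) = false} ≤ (1 / 2) ^ (2 * H) := by
  by_cases hd : p ≤ y ∨ y + H ≤ p - H
  · have hcard : (Finset.Ico y (y + H) ∪ Finset.Ico (p - H) p).card = 2 * H := by
      rw [Finset.card_union_of_disjoint]
      · simp; omega
      · rw [Finset.disjoint_left]
        intro z h1 h2
        rw [Finset.mem_Ico] at h1 h2
        omega
    rw [← hcard, ← fairReal_cylinder _ fun z => decide (y ≤ z ∧ z < y + H)]
    refine measureReal_mono ?_
    rintro e ⟨h1, h2⟩ z hz
    rw [Finset.mem_union, Finset.mem_Ico, Finset.mem_Ico] at hz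
    rcases hz with hz | hz
    · exact h1 z (Finset.mem_Icc.2 (by omega))
    · have := h2 (p - 1 - z).toNat (by omega)
      rw [show p - 1 - ((p - 1 - z).toNat : ℤ) = z by omega] at this
      rw [this, eq_comm, decide_eq_false_iff_not]
      omega
  · have hempty : {e : ℤ → Bool |
        (∀ z ∈ Finset.Icc (y - 1) (y + H), e z = decide (y ≤ z ∧ z < y + H)) ∧
          ∀ i < H, e (p - 1 - i) = false} ⊆ ∅ := by
      rintro e ⟨h1, h2⟩
      rcases le_or_gt p (y + H) with hle | hlt
      · have h3 := h1 (p - 1) (Finset.mem_Icc.2 (by omega))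
        have h4 := h2 0 (by omega)
        rw [Nat.cast_zero, sub_zero, h3, decide_eq_false_iff_not] at h4
        omega
      · have h3 := h1 (y + H - 1) (Finset.mem_Icc.2 (by omega))
        have h4 := h2 (p - y - H).toNat (by omega)
        rw [show p - 1 - ((p - y - H).toNat : ℤ) = y + H - 1 by omega, h3,
          decide_eq_false_iff_not] at h4
        omega
    rw [Set.subset_empty_iff.1 hempty]
    simp

/-- With `t = (1 / 2) ^ H`, the framed run has probability `t / 4`, and competing runs nearby cost
at most a multiple of `D * t ^ 2`. The hypothesis `hH` keeps this cost below `t / 8`. -/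
theorem fairReal_not_beacon_le (y : ℤ) {D H : ℕ} (hD : 1 ≤ D) (hH : 32 * D ≤ 2 ^ H) (hH1 : 1 ≤ H) :
    (fair ℤ).real {e | ¬Beacon e y D H} ≤ 1 - (1 / 2) ^ (H + 3) := by
  set core : Set (ℤ → Bool) :=
    {e | ∀ z ∈ Finset.Icc (y - 1) (y + H), e z = decide (y ≤ z ∧ z < y + H)} with hcore
  set N := Finset.Icc (y - D) (y + D) with hN
  set Rt : ℤ → Set (ℤ → Bool) := fun p => {e | (∀ z ∈ Finset.Icc (y - 1) (y + H),
    e z = decide (y ≤ z ∧ z < y + H)) ∧ ∀ i < H, e (p + i) = true} with hRt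
  set Rf : ℤ → Set (ℤ → Bool) := fun p => {e | (∀ z ∈ Finset.Icc (y - 1) (y + H),
    e z = decide (y ≤ z ∧ z < y + H)) ∧ ∀ i < H, e (p - 1 - i) = false} with hRf
  have hsub : core ⊆ {e | Beacon e y D H} ∪ ((⋃ p ∈ N.erase y, Rt p) ∪ ⋃ p ∈ N, Rf p) := by
    intro e he
    by_cases hc : e ∈ (⋃ p ∈ N.erase y, Rt p) ∪ ⋃ p ∈ N, Rf p
    · exact Or.inr hc
    · left
      simp only [Set.mem_union, Set.mem_iUnion, not_or, not_exists, hRt, hRf, Set.mem_ofPred_eq,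
        not_and] at hc
      refine ⟨fun i hi => ?_, fun p hp hpy => ?_, fun p hpy => ?_⟩
      · rw [he (y + i) (Finset.mem_Icc.2 (by omega)), decide_eq_true_iff]; omega
      · rw [abs_lt] at hpy
        have := hc.1 p (Finset.mem_erase.2 ⟨hp, Finset.mem_Icc.2 (by omega)⟩) he
        simpa using this
      · rw [abs_lt] at hpy
        have := hc.2 p (Finset.mem_Icc.2 (by omega)) he
        simpa using this
  have hcoreP : (fair ℤ).real core = (1 / 2) ^ (H + 2) := by
    rw [hcore, fairReal_cylinder]
    congr 1
    simp; omega
  have hNc : (N.card : ℝ) = 2 * D + 1 := by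
    have : N.card = 2 * D + 1 := by simp [hN]; omega
    rw [this]; push_cast; ring
  have h1 : (fair ℤ).real (⋃ p ∈ N.erase y, Rt p) ≤ 2 * D * (1 / 2) ^ (2 * H + 2) := by
    refine (measureReal_biUnion_finset_le _ _).trans
      ((Finset.sum_le_sum fun p hp => fairReal_run_true_le (Finset.mem_erase.1 hp).1).trans ?_)
    rw [Finset.sum_const, nsmul_eq_mul, Finset.card_erase_of_mem (by simp [hN]), Nat.cast_pred
      (Finset.card_pos.2 ⟨y, by simp [hN]⟩), hNc]
    exact le_of_eq (by ring)
  have h2 : (fair ℤ).real (⋃ p ∈ N, Rf p) ≤ (2 * D + 1) * (1 / 2) ^ (2 * H) := by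
    refine (measureReal_biUnion_finset_le _ _).trans
      ((Finset.sum_le_sum fun p hp => fairReal_run_false_le hH1).trans ?_)
    rw [Finset.sum_const, nsmul_eq_mul, hNc]
  have h3 : (fair ℤ).real core ≤ (fair ℤ).real {e | Beacon e y D H}
      + ((fair ℤ).real (⋃ p ∈ N.erase y, Rt p) + (fair ℤ).real (⋃ p ∈ N, Rf p)) :=
    (measureReal_mono hsub).trans ((measureReal_union_le _ _).trans
      (add_le_add le_rfl (measureReal_union_le _ _)))
  have hm : MeasurableSet {e | Beacon e y D H} :=
    MeasurableSet.of_compl (depOn_not_beacon y D H).measurableSet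
  have h4 : (fair ℤ).real {e | ¬Beacon e y D H} = 1 - (fair ℤ).real {e | Beacon e y D H} :=
    probReal_compl_eq_one_sub hm
  set t : ℝ := (1 / 2) ^ H with ht
  have ht0 : 0 < t := by positivity
  have hDt : 32 * (D * t) ≤ 1 := by
    have h5 : ((32 * D : ℕ) : ℝ) ≤ ((2 ^ H : ℕ) : ℝ) := by exact_mod_cast hH
    push_cast at h5
    have h6 : (2 : ℝ) ^ H * t = 1 := by rw [ht, ← mul_pow]; norm_num
    nlinarith
  have hD' : (1 : ℝ) ≤ D := by exact_mod_cast hD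
  have e1 : ((1 : ℝ) / 2) ^ (2 * H + 2) = t * t / 4 := by rw [ht]; ring
  have e2 : ((1 : ℝ) / 2) ^ (2 * H) = t * t := by rw [ht]; ring
  have e3 : ((1 : ℝ) / 2) ^ (H + 2) = t / 4 := by rw [ht]; ring
  have e4 : ((1 : ℝ) / 2) ^ (H + 3) = t / 8 := by rw [ht]; ring
  rw [e1] at h1
  rw [e2] at h2
  rw [hcoreP, e3] at h3
  rw [h4, e4]
  nlinarith [mul_le_mul_of_nonneg_right hDt ht0.le, mul_nonneg (sub_nonneg.2 hD') (mul_pos ht0 ht0).le]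

/-- The candidates for beacons on one side of `x`. -/
def cand (x c : ℤ) (D H m : ℕ) : ℤ := x + c * ((2 * (D + H) + 1) * (m + 1))

/-- The spacing `2 * (D + H) + 1` makes the windows of the candidates disjoint, so their failures
are independent. -/
theorem fairReal_no_beacon_le (x c : ℤ) (hc : c = 1 ∨ c = -1) {D H : ℕ} (hD : 1 ≤ D)
    (hH : 32 * D ≤ 2 ^ H) (hH1 : 1 ≤ H) (M : ℕ) :
    (fair ℤ).real {e | ∀ m < M, ¬Beacon e (cand x c D H m) D H} ≤ (1 - (1 / 2) ^ (H + 3)) ^ M := by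
  induction M with
  | zero => simp
  | succ M ih =>
    have hset : {e | ∀ m < M + 1, ¬Beacon e (cand x c D H m) D H}
        = {e | ¬Beacon e (cand x c D H M) D H}
          ∩ {e | ∀ m < M, ¬Beacon e (cand x c D H m) D H} := by
      ext e
      simp only [Set.mem_inter_iff, Set.mem_ofPred_eq, Nat.lt_succ_iff_lt_or_eq, or_imp,
        forall_and, forall_eq]
      exact and_comm
    have hind := fair_inter (depOn_not_beacon (cand x c D H M) D H)
      {e | ∀ m < M, ¬Beacon e (cand x c D H m) D H} fun i hi e he m hm hb => by
        refine he m hm (hb.congr fun z hz => flipAt_ne ?_ e)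
        rintro rfl
        rw [Finset.mem_Icc] at hi hz
        have h1 : (2 * ((D : ℤ) + H) + 1) * (m + 1) + (2 * ((D : ℤ) + H) + 1)
            ≤ (2 * ((D : ℤ) + H) + 1) * (M + 1) := by
          have : ((m : ℤ) + 1) + 1 ≤ M + 1 := by omega
          nlinarith
        unfold cand at hi hz
        rcases hc with rfl | rfl <;> omega
    rw [hset, measureReal_def, hind, ENNReal.toReal_mul, pow_succ']
    exact mul_le_mul (fairReal_not_beacon_le _ hD hH hH1) ih measureReal_nonneg
      (measureReal_nonneg.trans (fairReal_not_beacon_le x hD hH hH1))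

/-- The lower bound makes runs locally unique; the upper bound makes beacons frequent enough for `D
^ 2` candidates to suffice. -/
theorem exists_height (D : ℕ) (hD : 1 ≤ D) : ∃ H, 1 ≤ H ∧ 32 * D ≤ 2 ^ H ∧ 2 ^ H ≤ 64 * D := by
  refine ⟨Nat.log 2 (32 * D) + 1, by omega, (Nat.lt_pow_succ_log_self (by omega) _).le, ?_⟩
  have := Nat.pow_log_le_self 2 (x := 32 * D) (by omega)
  rw [pow_succ]
  omega

theorem fairReal_no_beacon_le_exp (x c : ℤ) (hc : c = 1 ∨ c = -1) {D H : ℕ} (hD : 1 ≤ D)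
    (hH : 32 * D ≤ 2 ^ H) (hH1 : 1 ≤ H) (hH2 : 2 ^ H ≤ 64 * D) :
    (fair ℤ).real {e | ∀ m < D ^ 2, ¬Beacon e (cand x c D H m) D H} ≤ Real.exp (-(D / 512)) := by
  refine (fairReal_no_beacon_le x c hc hD hH hH1 (D ^ 2)).trans ?_
  have hD' : (0 : ℝ) < D := by exact_mod_cast hD
  have h1 : 1 / (512 * D : ℝ) ≤ (1 / 2) ^ (H + 3) := by
    have h5 : ((2 ^ H : ℕ) : ℝ) ≤ ((64 * D : ℕ) : ℝ) := by exact_mod_cast hH2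
    push_cast at h5
    rw [one_div_pow]
    refine one_div_le_one_div_of_le (by positivity) ?_
    rw [pow_add]
    linarith
  have h2 : ((1 : ℝ) / 2) ^ (H + 3) ≤ 1 := pow_le_one₀ (by norm_num) (by norm_num)
  calc (1 - (1 / 2 : ℝ) ^ (H + 3)) ^ (D ^ 2) ≤ Real.exp (-(1 / (512 * D))) ^ (D ^ 2) := by
        refine pow_le_pow_left₀ (by linarith) ?_ _
        linarith [Real.add_one_le_exp (-(1 / (512 * D : ℝ)))]
    _ = Real.exp (-(D / 512)) := by
        rw [← Real.exp_nat_mul]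
        congr 1
        push_cast
        field_simp

/-- For almost every environment, the walk can escape from all followers in the environment
with the two edges at `x` turned. -/
theorem ae_exists_escape (x : ℤ) :
    ∀ᵐ e ∂fair ℤ, ∃ z₀, fair ℕ {s | ∃ q, ∀ n, Foll (tw x e) e z₀ s q n} < 1 := by
  obtain ⟨ε, hε, hgood⟩ := exists_not_good_bound
  have hbound : ∀ J : ℕ, 2 ≤ J →
      fair ℤ {e | ¬∃ z₀, fair ℕ {s | ∃ q, ∀ n, Foll (tw x e) e z₀ s q n} < 1}
        ≤ 2 * ENNReal.ofReal (Real.exp (-(J / 512))) + 32 * ε J := by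
    intro J hJ
    set D := dist7 J with hDdef
    have hD : 1 ≤ D := by have := dist7_lt J; omega
    obtain ⟨H, hH1, hH, hH2⟩ := exists_height D hD
    set NB : ℤ → Set (ℤ → Bool) := fun c => {e | ∀ m < D ^ 2, ¬Beacon e (cand x c D H m) D H}
      with hNB
    set GB : ℤ → ℤ → Set (ℤ → Bool) := fun c a =>
      ⋃ m ∈ Finset.range (D ^ 2), {e | ¬Good x J (cand x c D H m + a) e} with hGB
    -- Which candidates are beacons depends on the environment, so all of them are required to be
    -- good. The offsets `0` and `H` are those of the sites where `exists_escape` needs goodness.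
    have hsub : {e | ¬∃ z₀, fair ℕ {s | ∃ q, ∀ n, Foll (tw x e) e z₀ s q n} < 1}
        ⊆ (NB (-1) ∪ NB 1) ∪ (GB (-1) 0 ∪ GB 1 H) := by
      intro e he
      by_contra hc
      simp only [Set.mem_union, not_or, hNB, hGB, Set.mem_ofPred_eq, Set.mem_iUnion, not_exists,
        not_forall, not_not, exists_prop, Finset.mem_range] at hc
      obtain ⟨⟨⟨m, hm, hl⟩, m', hm', hr⟩, gl, gr⟩ := hc
      have gl' := not_not.1 fun h => gl m ⟨hm, h⟩
      rw [add_zero] at gl'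
      refine he (exists_escape hl hr ?_ ?_ gl' (not_not.1 fun h => gr m' ⟨hm', h⟩))
      · unfold cand
        have : (2 * ((D : ℤ) + H) + 1) * 1 ≤ (2 * ((D : ℤ) + H) + 1) * (m + 1) := by gcongr; omega
        omega
      · unfold cand
        have : (2 * ((D : ℤ) + H) + 1) * 1 ≤ (2 * ((D : ℤ) + H) + 1) * (m' + 1) := by
          gcongr; omega
        omega
    have hNBle : ∀ c : ℤ, c = 1 ∨ c = -1 →
        fair ℤ (NB c) ≤ ENNReal.ofReal (Real.exp (-(J / 512))) := by
      intro c hc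
      rw [← ENNReal.ofReal_toReal (a := fair ℤ (NB c)) (by finiteness)]
      refine ENNReal.ofReal_le_ofReal
        ((fairReal_no_beacon_le_exp x c hc hD hH hH1 hH2).trans (Real.exp_le_exp.2 ?_))
      have : (J : ℝ) ≤ D := by exact_mod_cast (dist7_lt J).le
      linarith
    -- The number of candidates is absorbed by the weight `J ^ 14` in `exists_not_good_bound`.
    have hDJ : (D : ℝ≥0∞) ^ 2 ≤ 16 * (J : ℝ≥0∞) ^ 14 := by
      have h1 : D ≤ 4 * J ^ 7 := by
        have : 1 ≤ J ^ 7 := Nat.one_le_pow _ _ (by omega)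
        rw [hDdef, dist7]; omega
      have h2 : D ^ 2 ≤ 16 * J ^ 14 := (Nat.pow_le_pow_left h1 2).trans (le_of_eq (by ring))
      exact_mod_cast h2
    have hGBle : ∀ c a : ℤ, fair ℤ (GB c a) ≤ 16 * ε J := by
      intro c a
      calc fair ℤ (GB c a) ≤ ∑ m ∈ Finset.range (D ^ 2),
            fair ℤ {e | ¬Good x J (cand x c D H m + a) e} := measure_biUnion_finset_le _ _
        _ ≤ ∑ m ∈ Finset.range (D ^ 2), ε J / (J : ℝ≥0∞) ^ 14 := by
            refine Finset.sum_le_sum fun m _ => ?_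
            rw [ENNReal.le_div_iff_mul_le (Or.inl (by simp; omega)) (Or.inl (by finiteness)),
              mul_comm]
            exact hgood x J _ hJ
        _ ≤ 16 * (J : ℝ≥0∞) ^ 14 * (ε J / (J : ℝ≥0∞) ^ 14) := by
            rw [Finset.sum_const, nsmul_eq_mul, Finset.card_range]
            push_cast
            gcongr
        _ = 16 * ε J := by
            rw [mul_assoc, ENNReal.mul_div_cancel (by simp; omega) (by finiteness)]
    calc _ ≤ (fair ℤ (NB (-1)) + fair ℤ (NB 1)) + (fair ℤ (GB (-1) 0) + fair ℤ (GB 1 H)) :=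
          (measure_mono hsub).trans ((measure_union_le _ _).trans
            (add_le_add (measure_union_le _ _) (measure_union_le _ _)))
      _ ≤ (ENNReal.ofReal (Real.exp (-(J / 512))) + ENNReal.ofReal (Real.exp (-(J / 512))))
          + (16 * ε J + 16 * ε J) :=
          add_le_add (add_le_add (hNBle _ (by simp)) (hNBle _ (by simp)))
            (add_le_add (hGBle _ _) (hGBle _ _))
      _ = _ := by ring
  have hlim : Filter.Tendsto (fun J : ℕ => 2 * ENNReal.ofReal (Real.exp (-(J / 512))) + 32 * ε J)
      Filter.atTop (nhds 0) := by
    have h1 : Filter.Tendsto (fun J : ℕ => Real.exp (-((J : ℝ) / 512))) Filter.atTop (nhds 0) :=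
      Real.tendsto_exp_neg_atTop_nhds_zero.comp
        (tendsto_natCast_atTop_atTop.atTop_div_const (by norm_num))
    have h2 := ENNReal.tendsto_ofReal h1
    have h3 := (ENNReal.Tendsto.const_mul (a := 2) h2 (Or.inr (by simp))).add
      (ENNReal.Tendsto.const_mul (a := 32) hε (Or.inr (by simp)))
    simpa using h3
  rw [ae_iff]
  refine le_antisymm (ge_of_tendsto hlim ?_) bot_le
  filter_upwards [Filter.eventually_ge_atTop 2] with J hJ using hbound J hJ

/-! ### From colors to edges -/

/-- The bit of an edge tells whether its end points have the same color, turned at odd sites. -/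
def env (ξ : Scenery) : ℤ → Bool := fun z => xor (decide (ξ z = ξ (z + 1))) (decide (z % 2 = 1))

/-- A downward crossing starts at a site of the other parity than an upward crossing of the same
edge; this supplies the negation in `inc`. The symbol thus depends only on the two colors seen and
on the parity of the current site. -/
theorem inc_env (ξ : Scenery) (z : ℤ) (b : Bool) :
    inc (env ξ) z b = xor (decide (ξ z = ξ (z + st b))) (decide (z % 2 = 1)) := by
  cases b
  · have h1 : z - 1 + 1 = z := by ring
    have h2 : decide ((z - 1) % 2 = 1) = !decide (z % 2 = 1) := by
      rw [← decide_not]; congr 1; simp only [eq_iff_iff]; omega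
    have h3 : decide (ξ (z - 1) = ξ z) = decide (ξ z = ξ (z - 1)) := by
      congr 1; simp only [eq_iff_iff]; exact eq_comm
    simp only [inc, env, st_false, h1, h2, h3, ← sub_eq_add_neg]
    simp
  · rfl

theorem env_eq_tw {ξ η : Scenery} {x : ℤ} (hx : η x ≠ ξ x) (hu : ∀ y, η y ≠ ξ y → y = x) :
    env η = tw x (env ξ) := by
  have hne : ∀ a b c : Fin 2, b ≠ a → decide (b = c) = !decide (a = c) := by decide
  have hne' : ∀ a b c : Fin 2, b ≠ a → decide (c = b) = !decide (c = a) := by decide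
  have hu' : ∀ y, y ≠ x → η y = ξ y := fun y hy => by
    by_contra hc; exact hy (hu y hc)
  funext z
  simp only [env, tw]
  by_cases h1 : z = x
  · subst h1
    rw [hu' (z + 1) (by omega), hne _ _ _ hx, decide_eq_true (p := z = z - 1 ∨ z = z) (by simp)]
    simp
  · by_cases h2 : z = x - 1
    · have h3 : z + 1 = x := by omega
      rw [h3, hu' z h1, hne' _ _ _ hx, decide_eq_true (p := z = x - 1 ∨ z = x) (by simp [h2])]
      simp
    · rw [hu' z h1, hu' (z + 1) (by omega),
        decide_eq_false (p := z = x - 1 ∨ z = x) (by simp [h1, h2]), Bool.xor_false]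

theorem measurable_env : Measurable env := by
  refine measurable_pi_lambda _ fun z => ?_
  have h : Measurable fun ξ : Scenery => (ξ z, ξ (z + 1)) :=
    (measurable_pi_apply z).prodMk (measurable_pi_apply (z + 1))
  exact (measurable_of_finite fun p : Fin 2 × Fin 2 =>
    xor (decide (p.1 = p.2)) (decide (z % 2 = 1))).comp h

/-- The edges of a random scenery are independent and fair. -/
theorem map_env : sceneryMeasure.map env = fair ℤ := by
  have : IsProbabilityMeasure (sceneryMeasure.map env) :=
    Measure.isProbabilityMeasure_map measurable_env.aemeasurable
  refine eq_fair_of_flip fun i => ?_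
  -- Exchanging the two colors at all sites to the right of `i` preserves the law of the scenery and
  -- turns the edge `i` alone.
  set f : ℤ → Fin 2 → Fin 2 := fun j c => if i < j then 1 - c else c with hf
  have hfm : Measurable fun (ξ : Scenery) j => f j (ξ j) :=
    measurable_pi_lambda _ fun j => (measurable_of_finite (f j)).comp (measurable_pi_apply j)
  have hinv : sceneryMeasure.map (fun ξ j => f j (ξ j)) = sceneryMeasure := by
    rw [sceneryMeasure, Measure.infinitePi_map_pi _ fun j => measurable_of_finite (f j)]
    congr 1
    funext j
    rw [bernoulli_oneHalf_map _ _ (measurable_of_finite _)]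
    by_cases hj : i < j
    · simpa [hf, hj] using bernoulli_oneHalf_comm _ _
    · simp [hf, hj]
  rw [Measure.map_map (measurable_flipAt i) measurable_env]
  conv_rhs => rw [← hinv, Measure.map_map measurable_env hfm]
  congr 1
  funext ξ z
  have h2 : ∀ a b : Fin 2, decide (a = 1 - b) = !decide (a = b) := by decide
  simp only [Function.comp_apply, flipAt, env, hf]
  by_cases hz : z = i
  · subst hz
    simp [h2]
  · by_cases hz' : i < z
    · simp [hz, hz', show i < z + 1 by omega]
    · simp [hz, hz', show ¬i < z + 1 by omega]

/-! ### The walk -/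

theorem walk_st (s : ℕ → Bool) : walk (fun i => st (s i)) = pos 0 s := by
  funext k
  induction k with
  | zero => simp [walk]
  | succ k ih => rw [pos_succ, ← ih, walk, walk, Finset.sum_range_succ]

theorem measurable_path : Measurable (pos 0) :=
  measurable_pi_lambda _ fun n => measurable_pos 0 n

theorem simpleRandomWalk_eq : simpleRandomWalk = (fair ℕ).map (pos 0) := by
  have h : stepMeasure = (fair ℕ).map fun s i => st (s i) := by
    rw [stepMeasure, fair, Measure.infinitePi_map_pi _ fun _ => measurable_of_finite st]
    congr 1
    funext j
    rw [bernoulli_oneHalf_map _ _ (measurable_of_finite _)]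
    rfl
  rw [simpleRandomWalk, h, Measure.map_map measurable_walk]
  · congr 1
    funext s
    exact walk_st s
  · exact measurable_pi_lambda _ fun i => (measurable_of_finite st).comp (measurable_pi_apply i)

theorem pos_emod_two (z : ℤ) (s : ℕ → Bool) (n : ℕ) : pos z s n % 2 = (z + n) % 2 := by
  induction n with
  | zero => simp
  | succ n ih =>
    rw [pos_succ]; push_cast
    rcases st_eq_or (s n) with h | h <;> rw [h] <;> omega

/-- The color records that agree, up to any time, with the record of some path in `η`. -/
def possibleRecords (η : Scenery) : Set (ℕ → Fin 2) :=
  {X | ∀ n, ∃ τ : ℕ → Bool, ∀ i < n, X i = η (pos 0 τ i)}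

theorem measurableSet_possibleRecords (η : Scenery) : MeasurableSet (possibleRecords η) := by
  have h : possibleRecords η = ⋂ n : ℕ, ⋃ w : Fin n → Bool, ⋂ i : Fin n,
      {X | X i = η (pos 0 (fun k => if h : k < n then w ⟨k, h⟩ else false) i)} := by
    ext X
    simp only [possibleRecords, Set.mem_ofPred_eq, Set.mem_iInter, Set.mem_iUnion]
    refine forall_congr' fun n => ⟨?_, ?_⟩
    · rintro ⟨τ, hτ⟩
      refine ⟨fun i => τ i, fun i => ?_⟩
      rw [hτ i i.2]
      congr 1
      refine pos_congr 0 fun k hk => ?_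
      rw [dif_pos (hk.trans i.2)]
    · rintro ⟨w, hw⟩
      exact ⟨_, fun i hi => hw ⟨i, hi⟩⟩
  rw [h]
  exact MeasurableSet.iInter fun n => MeasurableSet.iUnion fun w => MeasurableSet.iInter fun i =>
    measurableSet_eq_fun (measurable_pi_apply _) measurable_const

/-- Both paths start at the origin, so their sites have equal parity at equal times and the parity
twists agree. The `n` symbols require `n + 1` colors. -/
theorem foll_of_possibleRecords {ξ η : Scenery} {s : ℕ → Bool}
    (h : colorRecord ξ (pos 0 s) ∈ possibleRecords η) (n : ℕ) :
    Foll (env η) (env ξ) 0 s 0 n := by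
  obtain ⟨τ, hτ⟩ := h (n + 1)
  refine ⟨τ, fun i hi => ?_⟩
  have h1 : ξ (pos 0 s i) = η (pos 0 τ i) := hτ i (by omega)
  have h2 : ξ (pos 0 s (i + 1)) = η (pos 0 τ (i + 1)) := hτ (i + 1) (by omega)
  rw [inc_env, inc_env, ← pos_succ, ← pos_succ, h1, h2, pos_emod_two, pos_emod_two]

theorem measurable_colorRecord (ξ : Scenery) : Measurable (colorRecord ξ) :=
  measurable_pi_lambda _ fun k => (measurable_of_countable ξ).comp (measurable_pi_apply k)

theorem distinguishable_of_escape {ξ η : Scenery} {x z₀ : ℤ} (hx : η x ≠ ξ x)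
    (hu : ∀ y, η y ≠ ξ y → y = x)
    (h : fair ℕ {s | ∃ q, ∀ n, Foll (tw x (env ξ)) (env ξ) z₀ s q n} < 1) :
    Distinguishable ξ η := by
  have hm := measurableSet_possibleRecords η
  refine ⟨(possibleRecords η)ᶜ, hm.compl, ?_, ?_⟩
  · rw [simpleRandomWalk_eq, ae_map_iff measurable_path.aemeasurable
      (measurable_colorRecord ξ hm.compl), ae_iff]
    refine measure_mono_null (fun s hs => ?_) (foll_null h)
    intro n
    rw [← env_eq_tw hx hu]
    exact foll_of_possibleRecords (not_not.1 hs) n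
  · have hm' : MeasurableSet {S | colorRecord η S ∉ (possibleRecords η)ᶜ} :=
      (measurable_colorRecord η hm.compl).compl
    rw [simpleRandomWalk_eq, ae_map_iff measurable_path.aemeasurable hm']
    exact Filter.Eventually.of_forall fun s hs => hs fun n => ⟨s, fun i _ => rfl⟩

end SceneryReconstruction

theorem corollary2 :
    ∃ 𝕊 : Set SceneryReconstruction.Scenery,
      MeasurableSet 𝕊 ∧ SceneryReconstruction.sceneryMeasure 𝕊 = 1 ∧
        ∀ ξ ∈ 𝕊, ∀ η : SceneryReconstruction.Scenery,
          SceneryReconstruction.DifferInOnePoint ξ η →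
            SceneryReconstruction.Distinguishable ξ η := by
  open SceneryReconstruction in
  have hae : ∀ᵐ ξ ∂sceneryMeasure, ∀ x : ℤ, ∃ z₀,
      fair ℕ {s | ∃ q, ∀ n, Foll (tw x (env ξ)) (env ξ) z₀ s q n} < 1 := by
    rw [ae_all_iff]
    intro x
    have h := ae_exists_escape x
    rw [← map_env] at h
    exact ae_of_ae_map measurable_env.aemeasurable h
  -- The set of sceneries allowing an escape at every `x` is not shown to be measurable, so the
  -- complement of a measurable null set containing the exceptions is used.
  obtain ⟨N, hsub, hN, hN0⟩ := exists_measurable_superset_of_null (ae_iff.1 hae)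
  refine ⟨Nᶜ, hN.compl, (prob_compl_eq_one_iff hN).2 hN0, ?_⟩
  rintro ξ hξ η ⟨x, hx, hu⟩
  obtain ⟨z₀, hz₀⟩ := not_not.1 (fun hc => hξ (hsub hc)) x
  exact SceneryReconstruction.distinguishable_of_escape hx hu hz₀
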